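/- **Theorem.** Let $\Omega\subset\mathbb R^2$ be a bounded domain (not necessarily simply connected) with polygonal Lipschitz boundary $\Gamma$. Write $\Gamma=\mathcal V\cup E_1\cup\dots\cup E_K$, where $\mathcal V$ is the finite set of corner points and the $E_k$ are the edges (open line segments); a corner point may have interior angle $\pi$. Let $n=(n_1,n_2)^T$ be the unit outer normal and $t=(-n_2,n_1)^T$ the unit counterclockwise tangent on the edges. Let each edge be assigned to exactly one of the (possibly empty) boundary parts $\Gamma_c$ (clamped), $\Gamma_s$ (simply supported), $\Gamma_f$ (free). Set $$W=\{v\in H^2(\Omega): v=0 \text{ on }\Gamma_c\cup\Gamma_s,\ \tfrac{\partial v}{\partial n}=0\text{ on }\Gamma_c\},\qquad Q=\{v\in H^1(\Omega): v=0\text{ on }\Gamma_c\cup\Gamma_s\},$$ where boundary values are traces and $Q$ carries the norm $\|v\|_Q=\|v\|_{H^1(\Omega)}$. Let $L^2(\Omega)_{\rm sym}$ be the space of symmetric $2\times2$ matrix-valued functions with entries in $L^2(\Omega)$, and let $$H(\operatorname{div}\operatorname{Div},Q^*)=\Big\{N\in L^2(\Omega)_{\rm sym}:\ \text{the functional } v\mapsto\int_\Omega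 \nabla^2 v:N\,dx,\ v\in W,\ \text{is bounded w.r.t. the } Q\text{-norm}\Big\},$$ where $A:B=\sum_{i,j}A_{ij}B_{ij}$. Write $N_{nn}=Nn\cdot n$ and $N_{nt}=Nn\cdot t$. Let $\mathcal V_f$ be the set of corner points both of whose adjacent edges belong to $\Gamma_f$, and for $x\in\mathcal V_f$ with adjacent edges having normals $n_1,n_2$ and tangents $t_1,t_2$ put $$[\![N_{nt}]\!]_x=N(x)n_1\cdot t_1-N(x)n_2\cdot t_2 .$$ Let $N\in L^2(\Omega)_{\rm sym}\cap C^1(\overline\Omega)$, i.e. $N$ and its first derivatives in $\Omega$ extend continuously to $\overline\Omega$. Then $N\in H(\operatorname{div}\operatorname{Div},Q^*)$ if and only if $$N_{nn}=0\ \text{ on every edge in }\Gamma_s\cup\Gamma_f\qquad\text{and}\qquad [\![N_{nt}]\!]_x=0\ \text{ for all }x\in\mathcal V_f .$$ -/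

import Mathlib

open MeasureTheory Filter Topology Set
open scoped ContDiff ENNReal

noncomputable section

namespace Plate

/-- The Euclidean plane. -/
abbrev Plane : Type := EuclideanSpace ℝ (Fin 2)

/-- Two-dimensional cross product; positive iff `w` points to the left of `v`. -/
def cross (v w : Plane) : ℝ := v 0 * w 1 - v 1 * w 0

/-- `y` lies strictly to the left of the oriented line from `a` to `b`. -/
def LeftOf (a b y : Plane) : Prop := 0 < cross (b - a) (y - a)

/-- Unit vector pointing from `a` to `b`. -/
def unitTangent (a b : Plane) : Plane := ‖b - a‖⁻¹ • (b - a)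

/-- Unit vector `n` with `t = (-n₂, n₁)` for `t = unitTangent a b`, i.e. the unit normal of the
segment from `a` to `b` that points to its right. -/
def unitNormal (a b : Plane) : Plane := !₂[unitTangent a b 1, -(unitTangent a b 0)]

/-- A bounded domain in the plane with polygonal Lipschitz boundary (not necessarily simply
connected), together with a decomposition of its boundary into corner points and open edges.
Edge `k` runs from `vertex k` to `vertex (next k)` and has the domain on its left (so that outer
boundary components are run through counterclockwise). Near a corner the domain is an open circular
sector of opening angle strictly between `0` and `2π`, bounded by the two adjacent edges;
flat corners (angle `π`) are allowed, since the boundary condition may change there. -/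
structure PolygonalDomain where
  /-- The domain itself. -/
  Ω : Set Plane
  isOpen : IsOpen Ω
  isConnected : IsConnected Ω
  isBounded : Bornology.IsBounded Ω
  /-- Number of edges, which equals the number of corner points. -/
  K : ℕ
  /-- The corner points. -/
  vertex : Fin K → Plane
  /-- The successor of an edge along its boundary component. -/
  next : Equiv.Perm (Fin K)
  vertex_injective : Function.Injective vertex
  next_ne : ∀ k, next k ≠ k
  vertex_notMem : ∀ k l, vertex l ∉ openSegment ℝ (vertex k) (vertex (next k))
  edges_disjoint : ∀ k l, k ≠ l →
    Disjoint (openSegment ℝ (vertex k) (vertex (next k)))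
      (openSegment ℝ (vertex l) (vertex (next l)))
  frontier_eq : frontier Ω = ⋃ k, segment ℝ (vertex k) (vertex (next k))
  /-- Near a point of an open edge the domain is the half disc to the left of the edge. -/
  edge_local : ∀ k, ∀ x ∈ openSegment ℝ (vertex k) (vertex (next k)),
    ∃ r > 0, ∀ y ∈ Metric.ball x r, y ∈ Ω ↔ LeftOf (vertex k) (vertex (next k)) y
  /-- No cusps and no slits: the two edges at a corner do not leave it in the same direction. -/
  corner_ne : ∀ k, ¬ SameRay ℝ (vertex k - vertex (next k))
    (vertex (next (next k)) - vertex (next k))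
  /-- Convex (or flat) corners: sector of angle at most `π`. -/
  corner_convex : ∀ k,
    0 ≤ cross (vertex (next k) - vertex k) (vertex (next (next k)) - vertex (next k)) →
    ∃ r > 0, ∀ y ∈ Metric.ball (vertex (next k)) r,
      y ∈ Ω ↔ LeftOf (vertex k) (vertex (next k)) y ∧
        LeftOf (vertex (next k)) (vertex (next (next k))) y
  /-- Reentrant corners: sector of angle greater than `π`. -/
  corner_reentrant : ∀ k,
    cross (vertex (next k) - vertex k) (vertex (next (next k)) - vertex (next k)) < 0 →
    ∃ r > 0, ∀ y ∈ Metric.ball (vertex (next k)) r,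
      y ∈ Ω ↔ LeftOf (vertex k) (vertex (next k)) y ∨
        LeftOf (vertex (next k)) (vertex (next (next k))) y

namespace PolygonalDomain

variable (P : PolygonalDomain)

/-- The open edge `E_k`. -/
def edge (k : Fin P.K) : Set Plane := openSegment ℝ (P.vertex k) (P.vertex (P.next k))

/-- The unit counterclockwise tangent vector on edge `k`. -/
def tangent (k : Fin P.K) : Plane := unitTangent (P.vertex k) (P.vertex (P.next k))

/-- The unit outer normal vector on edge `k`. -/
def normal (k : Fin P.K) : Plane := unitNormal (P.vertex k) (P.vertex (P.next k))

end PolygonalDomain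

/-- The type of boundary condition prescribed on an edge. -/
inductive BoundaryType where
  | clamped
  | simplySupported
  | free

/-- Classical partial derivative `∂φ/∂x_i`. -/
def partialDeriv (i : Fin 2) (φ : Plane → ℝ) (x : Plane) : ℝ :=
  fderiv ℝ φ x (EuclideanSpace.single i 1)

/-- `g` is the weak partial derivative of `u` in direction `i` on the open set `Ω`
(used for `u`, `g` in `L²(Ω)`). -/
def HasWeakPartial (Ω : Set Plane) (i : Fin 2) (u g : Plane → ℝ) : Prop :=
  ∀ φ : Plane → ℝ, ContDiff ℝ ∞ φ → HasCompactSupport φ → tsupport φ ⊆ Ω →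
    ∫ x in Ω, u x * partialDeriv i φ x = - ∫ x in Ω, g x * φ x

/-- `u ∈ L²(Ω)`. -/
abbrev MemL2 (Ω : Set Plane) (u : Plane → ℝ) : Prop := MemLp u 2 (volume.restrict Ω)

/-- `v ∈ H²(Ω)` with weak gradient `G` and weak Hessian `H` (`H i j = ∂_j ∂_i v`). -/
structure IsH2 (Ω : Set Plane) (v : Plane → ℝ) (G : Fin 2 → Plane → ℝ)
    (H : Fin 2 → Fin 2 → Plane → ℝ) : Prop where
  memL2 : MemL2 Ω v
  memL2_grad : ∀ i, MemL2 Ω (G i)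
  memL2_hess : ∀ i j, MemL2 Ω (H i j)
  grad : ∀ i, HasWeakPartial Ω i v (G i)
  hess : ∀ i j, HasWeakPartial Ω j (G i) (H i j)

/-- The `H¹(Ω)`-norm of `v` with weak gradient `G`. -/
def normH1 (Ω : Set Plane) (v : Plane → ℝ) (G : Fin 2 → Plane → ℝ) : ℝ :=
  √((∫ x in Ω, v x ^ 2) + ∑ i, ∫ x in Ω, G i x ^ 2)

/-- The graph of the trace operator `H¹(Ω) → L²(Γ)`, `Γ = ∂Ω`, the continuous extension of
`φ ↦ φ|_Γ`, `φ ∈ C^∞(Ω̄)`: `γ ∈ L²(Γ)` (with respect to arc length) is the trace of `u ∈ H¹(Ω)`,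
where `G` is the weak gradient of `u`, if some functions `φ_n` that are smooth up to the boundary
converge to `u` in `H¹(Ω)` while their restrictions converge to `γ` in `L²(Γ)`. -/
def IsTrace (Ω : Set Plane) (u : Plane → ℝ) (G : Fin 2 → Plane → ℝ) (γ : Plane → ℝ) : Prop :=
  MemLp γ 2 (μH[1].restrict (frontier Ω)) ∧
  ∃ φ : ℕ → Plane → ℝ, (∀ n, ContDiff ℝ ∞ (φ n)) ∧
    Tendsto (fun n => eLpNorm (φ n - u) 2 (volume.restrict Ω)) atTop (𝓝 0) ∧
    (∀ i, Tendsto (fun n => eLpNorm (partialDeriv i (φ n) - G i) 2 (volume.restrict Ω))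
      atTop (𝓝 0)) ∧
    Tendsto (fun n => eLpNorm (φ n - γ) 2 (μH[1].restrict (frontier Ω))) atTop (𝓝 0)

/-- The space `W` of all `v ∈ H²(Ω)` with `v = 0` on clamped and simply supported edges and
`∂v/∂n = 0` on clamped edges, in the sense of traces. The weak gradient `G` and the weak Hessian
`H` of `v` are carried along; they are determined by `v` almost everywhere in the domain. -/
structure MemW (P : PolygonalDomain) (bc : Fin P.K → BoundaryType) (v : Plane → ℝ)
    (G : Fin 2 → Plane → ℝ) (H : Fin 2 → Fin 2 → Plane → ℝ) : Prop where
  isH2 : IsH2 P.Ω v G H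
  value_eq_zero : ∃ γ : Plane → ℝ, IsTrace P.Ω v G γ ∧
    ∀ k, bc k = .clamped ∨ bc k = .simplySupported →
      ∀ᵐ x ∂(μH[1].restrict (P.edge k)), γ x = 0
  normal_deriv_eq_zero : ∃ γ : Fin 2 → Plane → ℝ, (∀ i, IsTrace P.Ω (G i) (H i) (γ i)) ∧
    ∀ k, bc k = .clamped →
      ∀ᵐ x ∂(μH[1].restrict (P.edge k)), ∑ i, γ i x * P.normal k i = 0

/-- `N ∈ L²(Ω)_sym`: symmetric matrix-valued functions with entries in `L²(Ω)`. -/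
def MemL2Sym (Ω : Set Plane) (N : Plane → Matrix (Fin 2) (Fin 2) ℝ) : Prop :=
  (∀ i j, MemL2 Ω (fun x => N x i j)) ∧ ∀ᵐ x ∂(volume.restrict Ω), (N x).IsSymm

/-- `N ∈ H(divDiv, Q*)`: the functional `v ↦ ∫_Ω ∇²v : N dx` on `W` is bounded with respect to the
norm of `Q = {v ∈ H¹(Ω) : v = 0 on Γ_c ∪ Γ_s}`, which is the `H¹(Ω)`-norm. -/
def MemHDivDiv (P : PolygonalDomain) (bc : Fin P.K → BoundaryType)
    (N : Plane → Matrix (Fin 2) (Fin 2) ℝ) : Prop :=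
  MemL2Sym P.Ω N ∧
  ∃ C : ℝ, ∀ (v : Plane → ℝ) (G : Fin 2 → Plane → ℝ) (H : Fin 2 → Fin 2 → Plane → ℝ),
    MemW P bc v G H →
      |∫ x in P.Ω, ∑ i, ∑ j, H i j x * N x i j| ≤ C * normH1 P.Ω v G

/-- `f ∈ C¹(Ω̄)`: `f` is `C¹` in the open set `Ω`, and `f` and its derivative extend continuously
to the closure (the extension of `f` being given by its own values there). -/
def IsC1UpToBoundary (Ω : Set Plane) (f : Plane → ℝ) : Prop :=
  ContinuousOn f (closure Ω) ∧
  ∃ f' : Plane → Plane →L[ℝ] ℝ, ContinuousOn f' (closure Ω) ∧ ∀ x ∈ Ω, HasFDerivAt f (f' x) x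

/-- The component `(A v) · w`. -/
def component (A : Matrix (Fin 2) (Fin 2) ℝ) (v w : Plane) : ℝ :=
  ∑ i, (∑ j, A i j * v j) * w i

/-- `N_nn = N n · n` at the point `x` of edge `k`. -/
def normalNormal (P : PolygonalDomain) (N : Plane → Matrix (Fin 2) (Fin 2) ℝ) (k : Fin P.K)
    (x : Plane) : ℝ :=
  component (N x) (P.normal k) (P.normal k)

/-- `N_nt = N n · t` at the point `x` of the closed edge `k`. -/
def normalTangential (P : PolygonalDomain) (N : Plane → Matrix (Fin 2) (Fin 2) ℝ) (k : Fin P.K)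
    (x : Plane) : ℝ :=
  component (N x) (P.normal k) (P.tangent k)

/-- The jump of `N_nt` at the corner point `vertex (next k)`, where the edges `k` and `next k`
meet. -/
def cornerJump (P : PolygonalDomain) (N : Plane → Matrix (Fin 2) (Fin 2) ℝ) (k : Fin P.K) : ℝ :=
  normalTangential P N k (P.vertex (P.next k)) -
    normalTangential P N (P.next k) (P.vertex (P.next k))

end Plate

end

/-! Integration by parts turns `∫ ∇²v : N` into `-∫ ∇v · Div N` plus the sum over the edges of `∫
(N_nn ∂_n v + N_nt ∂_t v)` (`integral_hess_mul`). The first term is bounded by the H¹ norm, so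
everything depends on the boundary term.

Sufficiency. The tangential derivative of `v` vanishes on every edge where the trace of `v` does
(`tangential_eq_zero`), so once `N_nn = 0` only `∫ N_nt ∂_t v` over the free edges is left. Since
`N_nt` has no jump between free edges, these edge functions extend to one function `ψ` with bounded
gradient in the domain (`exists_extension`). Near a corner `ψ` interpolates by a function of the
polar angle; its gradient grows like the inverse distance, but it multiplies a difference that
vanishes at the corner. Because `∇v` is curl free, the boundary integral of `ψ ∂_t v` equals `∫ (∂₁ψ
∂₂v - ∂₂ψ ∂₁v)` (`integral_tangential`), which the H¹ norm bounds. No trace estimate in a fractional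
space is needed.

Necessity of `N_nn = 0`. The H¹ norm does not control normal derivatives on an edge: `χ` times a
flattened distance to the edge vanishes there, has normal derivative `χ`, and tends to zero in H¹
(`tendsto_normH1_edgeTest`). Hence `∫ χ N_nn = 0` for all admissible `χ`.

Necessity of the corner conditions. Bumps shrinking to a corner make the boundary term tend to the
jump `J` (`tendsto_cornerForm`), but in the plane their Dirichlet integrals only stay bounded. A
point has zero capacity, however: for `n` bumps on widely separated scales the gradients have
disjoint supports, so the H¹ norm is `O(√n)` while the boundary term is close to `n J`. Thus `n |J|
≤ C √n` for all `n`, and `J = 0`.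

Underneath lies the Gauss theorem for functions that are bounded and C¹ up to the boundary except at
the corners (`gaussFormula`). It is localized to half planes, and the corners are cut out by bumps
whose contribution vanishes in the limit. -/

noncomputable section

namespace Plate

/-! ### The Gauss theorem on a half plane -/

section

/-- Integration in the coordinates of an orthonormal frame. -/
lemma integral_frame {T ν : Plane} (hT : ‖T‖ = 1) (hν : ‖ν‖ = 1) (hTν : inner ℝ T ν = 0)
    (x₀ : Plane) : MeasurableEmbedding (fun q : ℝ × ℝ => x₀ + q.1 • T + q.2 • ν) ∧
    MeasurePreserving (fun q : ℝ × ℝ => x₀ + q.1 • T + q.2 • ν) := by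
  have hon : Orthonormal ℝ ![T, ν] := by
    rw [orthonormal_iff_ite]
    intro i j
    fin_cases i <;> fin_cases j <;> simp [hT, hν, hTν, real_inner_comm]
  let b := OrthonormalBasis.mk hon (by
    have := hon.linearIndependent.span_eq_top_of_card_eq_finrank' (by simp)
    rw [this])
  have hb0 : b 0 = T := by simp [b]
  have hb1 : b 1 = ν := by simp [b]
  let e : ℝ × ℝ ≃ᵐ Plane := (MeasurableEquiv.finTwoArrow.symm.trans
    (MeasurableEquiv.toLp 2 (Fin 2 → ℝ))).trans
    (b.repr.symm.toHomeomorph.toMeasurableEquiv.trans (MeasurableEquiv.addLeft x₀))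
  have he : (fun q : ℝ × ℝ => x₀ + q.1 • T + q.2 • ν) = e := by
    funext q
    have : e q = x₀ + b.repr.symm (WithLp.toLp 2 ![q.1, q.2]) := rfl
    rw [this, ← b.sum_repr_symm]
    simp [Fin.sum_univ_two, hb0, hb1, add_assoc]
  rw [he]
  refine ⟨e.measurableEmbedding, ?_⟩
  have h1 : MeasurePreserving (MeasurableEquiv.finTwoArrow (α := ℝ)).symm :=
    (volume_preserving_finTwoArrow ℝ).symm
  have h2 : MeasurePreserving (MeasurableEquiv.toLp 2 (Fin 2 → ℝ)) :=
    (EuclideanSpace.volume_preserving_symm_measurableEquiv_toLp (Fin 2)).symm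
  have h3 := b.measurePreserving_repr_symm
  have h4 := measurePreserving_add_left (volume : Measure Plane) x₀
  exact h4.comp (h3.comp (h2.comp h1))

lemma inner_frame_expansion {T ν : Plane} (hT : ‖T‖ = 1) (hν : ‖ν‖ = 1) (hTν : inner ℝ T ν = 0)
    (w : Plane) : w = inner ℝ T w • T + inner ℝ ν w • ν := by
  have hon : Orthonormal ℝ ![T, ν] := by
    rw [orthonormal_iff_ite]
    intro i j
    fin_cases i <;> fin_cases j <;> simp [hT, hν, hTν, real_inner_comm]
  let b := OrthonormalBasis.mk hon (by
    have := hon.linearIndependent.span_eq_top_of_card_eq_finrank' (by simp)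
    rw [this])
  have := b.sum_repr' w
  simpa [Fin.sum_univ_two, b] using this.symm

lemma norm_frame_sq {T ν : Plane} (hT : ‖T‖ = 1) (hν : ‖ν‖ = 1) (hTν : inner ℝ T ν = 0)
    (s t : ℝ) : ‖s • T + t • ν‖ ^ 2 = s ^ 2 + t ^ 2 := by
  rw [norm_add_sq_real, norm_smul, norm_smul, inner_smul_left, inner_smul_right, hT, hν, hTν]
  simp

/-- The Gauss theorem on a half plane for functions of bounded support. -/
lemma gauss_halfPlane {T ν : Plane} (hT : ‖T‖ = 1) (hν : ‖ν‖ = 1) (hTν : inner ℝ T ν = 0)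
    (x₀ : Plane) {R : ℝ} (hR : 0 < R) {h : Plane → ℝ} {h' : Plane → Plane →L[ℝ] ℝ}
    (hc : ContinuousOn h {y | 0 ≤ inner ℝ ν (y - x₀)})
    (hd : ∀ y, 0 < inner ℝ ν (y - x₀) → HasFDerivAt h (h' y) y)
    (hc' : ContinuousOn h' {y | 0 < inner ℝ ν (y - x₀)})
    {M : ℝ} (hb' : ∀ y, 0 < inner ℝ ν (y - x₀) → ‖h' y‖ ≤ M)
    (hs : ∀ y, R ≤ ‖y - x₀‖ → h y = 0) (hs' : ∀ y, R ≤ ‖y - x₀‖ → h' y = 0) (w : Plane) :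
    ∫ y in {y | 0 < inner ℝ ν (y - x₀)}, h' y w = - inner ℝ ν w * ∫ s : ℝ, h (x₀ + s • T) := by
  obtain ⟨hme, hmp⟩ := integral_frame hT hν hTν x₀
  set Φ : ℝ × ℝ → Plane := fun q => x₀ + q.1 • T + q.2 • ν with hΦ
  have hΦc : Continuous Φ := by fun_prop
  have hinner : ∀ q, inner ℝ ν (Φ q - x₀) = q.2 := by
    intro q
    have : Φ q - x₀ = q.1 • T + q.2 • ν := by simp only [hΦ]; abel
    rw [this, inner_add_right, inner_smul_right, inner_smul_right, real_inner_comm, hTν,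
      real_inner_self_eq_norm_sq, hν]
    simp
  have hnorm : ∀ q, ‖Φ q - x₀‖ ^ 2 = q.1 ^ 2 + q.2 ^ 2 := by
    intro q
    have : Φ q - x₀ = q.1 • T + q.2 • ν := by simp only [hΦ]; abel
    rw [this, norm_frame_sq hT hν hTν]
  have hbig : ∀ q : ℝ × ℝ, R ^ 2 ≤ q.1 ^ 2 + q.2 ^ 2 → R ≤ ‖Φ q - x₀‖ := by
    intro q hq
    rw [← hnorm] at hq
    exact (pow_le_pow_iff_left₀ hR.le (norm_nonneg _) two_ne_zero).1 hq
  rw [← hmp.setIntegral_preimage_emb hme]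
  have hpre : Φ ⁻¹' {y | 0 < inner ℝ ν (y - x₀)} = univ ×ˢ Ioi (0 : ℝ) := by
    ext q; simp [hinner]
  rw [hpre]
  have hΦd : ∀ q, HasFDerivAt Φ
      ((ContinuousLinearMap.fst ℝ ℝ ℝ).smulRight T + (ContinuousLinearMap.snd ℝ ℝ ℝ).smulRight ν)
      q := by
    intro q
    have h1 : HasFDerivAt (fun q : ℝ × ℝ => q.1 • T)
      ((ContinuousLinearMap.fst ℝ ℝ ℝ).smulRight T) q :=
      ((ContinuousLinearMap.fst ℝ ℝ ℝ).smulRight T).hasFDerivAt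
    have h2 : HasFDerivAt (fun q : ℝ × ℝ => q.2 • ν)
      ((ContinuousLinearMap.snd ℝ ℝ ℝ).smulRight ν) q :=
      ((ContinuousLinearMap.snd ℝ ℝ ℝ).smulRight ν).hasFDerivAt
    exact (h1.const_add x₀).add h2
  set L : ℝ × ℝ →L[ℝ] Plane := (ContinuousLinearMap.fst ℝ ℝ ℝ).smulRight T +
    (ContinuousLinearMap.snd ℝ ℝ ℝ).smulRight ν
  -- Outside this rectangle a point of the half plane has distance at least `R` from `x₀`, where the
  -- integrand is zero.
  have hbox : ∀ q ∈ (univ : Set ℝ) ×ˢ Ioi (0 : ℝ) \ (Ioc (-R) R ×ˢ Ioc 0 R), h' (Φ q) w = 0 := by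
    rintro ⟨s, t⟩ ⟨⟨-, ht⟩, hq⟩
    rw [hs' _ (hbig _ ?_)]; · simp
    simp only [mem_Ioi] at ht
    by_contra! hcon
    refine hq ⟨⟨?_, ?_⟩, ht, ?_⟩ <;> simp at hcon ⊢ <;> nlinarith
  rw [setIntegral_eq_of_subset_of_forall_sdiff_eq_zero (MeasurableSet.univ.prod measurableSet_Ioi)
    (s := Ioc (-R) R ×ˢ Ioc 0 R) (fun q hq => ⟨trivial, hq.2.1⟩) hbox]
  have hint : IntegrableOn (fun q => h' (Φ q) w) (Ioc (-R) R ×ˢ Ioc 0 R) := by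
    refine ⟨?_, HasFiniteIntegral.restrict_of_bounded (C := M * ‖w‖) ?_ ?_⟩
    rotate_left
    · rw [Measure.volume_eq_prod, Measure.prod_prod, Real.volume_Ioc, Real.volume_Ioc]
      exact ENNReal.mul_lt_top ENNReal.ofReal_lt_top ENNReal.ofReal_lt_top
    rotate_left
    · refine ContinuousOn.aestronglyMeasurable ?_ (measurableSet_Ioc.prod measurableSet_Ioc)
      refine ContinuousOn.clm_apply (hc'.comp hΦc.continuousOn ?_) continuousOn_const
      intro q hq
      simp only [mem_ofPred_eq, hinner]; exact hq.2.1
    · rw [ae_restrict_iff' (measurableSet_Ioc.prod measurableSet_Ioc)]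
      refine ae_of_all _ fun q hq => ?_
      refine (ContinuousLinearMap.le_opNorm _ _).trans ?_
      gcongr
      exact hb' _ (by rw [hinner]; exact hq.2.1)
  -- The vector field is `h • w` written in the frame `T`, `ν`, so its divergence is the derivative
  -- of `h` along `w`. Of the four sides only the one on the boundary line contributes.
  have key := integral2_divergence_prod_of_hasFDerivAt_off_countable
    (fun q => inner ℝ T w * h (Φ q)) (fun q => inner ℝ ν w * h (Φ q))
    (fun q => inner ℝ T w • (h' (Φ q)).comp L) (fun q => inner ℝ ν w • (h' (Φ q)).comp L)
    (-R) 0 R R ∅ countable_empty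
  have hRR : -R ≤ R := by linarith
  rw [uIcc_of_le hRR, uIcc_of_le hR.le, min_eq_left hRR, max_eq_right hRR, min_eq_left hR.le,
    max_eq_right hR.le] at key
  have hcf : ContinuousOn (fun q : ℝ × ℝ => h (Φ q)) (Icc (-R) R ×ˢ Icc 0 R) := by
    refine hc.comp hΦc.continuousOn fun q hq => ?_
    simp only [mem_ofPred_eq, hinner]; exact hq.2.1
  have hdf : ∀ q ∈ Ioo (-R) R ×ˢ Ioo 0 R \ ∅,
      HasFDerivAt (fun q : ℝ × ℝ => h (Φ q)) ((h' (Φ q)).comp L) q := by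
    intro q hq
    exact (hd _ (by rw [hinner]; exact hq.1.2.1)).comp q (hΦd q)
  have heq : ∀ q, (inner ℝ T w • (h' (Φ q)).comp L) (1, 0) +
      (inner ℝ ν w • (h' (Φ q)).comp L) (0, 1) = h' (Φ q) w := by
    intro q
    conv_rhs => rw [inner_frame_expansion hT hν hTν w]
    simp [L]
  simp only [heq] at key
  have key := key (continuousOn_const.mul hcf) (continuousOn_const.mul hcf) (fun q hq => (hdf q hq).const_mul _)
    (fun q hq => (hdf q hq).const_mul _) (by
      refine hint.congr_set_ae ?_
      exact Measure.set_prod_ae_eq Ioc_ae_eq_Icc.symm Ioc_ae_eq_Icc.symm)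
  have hz1 : ∀ x : ℝ, h (Φ (x, R)) = 0 := fun x => hs _ (hbig _ (by simp; positivity))
  have hz2 : ∀ x : ℝ, h (Φ (R, x)) = 0 := fun x => hs _ (hbig _ (by simp; positivity))
  have hz3 : ∀ x : ℝ, h (Φ (-R, x)) = 0 := fun x => hs _ (hbig _ (by simp; positivity))
  simp only [hz1, hz2, hz3, mul_zero, intervalIntegral.integral_zero] at key
  rw [Measure.volume_eq_prod] at hint ⊢
  rw [setIntegral_prod _ hint, ← intervalIntegral.integral_of_le hRR]
  simp only [← intervalIntegral.integral_of_le hR.le]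
  rw [key, intervalIntegral.integral_const_mul, intervalIntegral.integral_of_le hRR]
  have : ∫ s in Ioc (-R) R, h (Φ (s, 0)) = ∫ s : ℝ, h (x₀ + s • T) := by
    rw [← setIntegral_univ (μ := volume) (f := fun s : ℝ => h (x₀ + s • T))]
    rw [setIntegral_eq_of_subset_of_forall_sdiff_eq_zero MeasurableSet.univ
      (s := Ioc (-R) R) (subset_univ _)]
    · simp [hΦ]
    · rintro s ⟨-, hs1⟩
      have h0 : x₀ + s • T = Φ (s, 0) := by simp [hΦ]
      rw [h0]
      refine hs _ (hbig _ ?_)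
      simp only [mem_Ioc, not_and_or, not_lt, not_le] at hs1
      rcases hs1 with h1 | h1 <;> simp <;> nlinarith
  rw [this]; ring

end

/-! ### Geometry of the edges; functions that are C¹ up to the boundary except at corners -/

section

lemma norm_unitTangent {a b : Plane} (h : a ≠ b) : ‖unitTangent a b‖ = 1 := by
  have : ‖b - a‖ ≠ 0 := norm_ne_zero_iff.2 (sub_ne_zero.2 h.symm)
  rw [unitTangent, norm_smul, norm_inv, norm_norm, inv_mul_cancel₀ this]

lemma norm_unitNormal {a b : Plane} (h : a ≠ b) : ‖unitNormal a b‖ = 1 := by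
  rw [← norm_unitTangent h]
  simp [unitNormal, EuclideanSpace.norm_eq, Fin.sum_univ_two, add_comm]

lemma inner_unitTangent_unitNormal (a b : Plane) :
    inner ℝ (unitTangent a b) (unitNormal a b) = 0 := by
  simp [unitNormal, PiLp.inner_apply, Fin.sum_univ_two]
  ring

lemma leftOf_iff_inner {a b : Plane} (h : a ≠ b) (y : Plane) :
    LeftOf a b y ↔ 0 < inner ℝ (-unitNormal a b) (y - a) := by
  have h0 : 0 < ‖b - a‖⁻¹ := inv_pos.2 (norm_pos_iff.2 (sub_ne_zero.2 h.symm))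
  have : inner ℝ (-unitNormal a b) (y - a) = ‖b - a‖⁻¹ * cross (b - a) (y - a) := by
    simp [unitNormal, unitTangent, cross, PiLp.inner_apply, Fin.sum_univ_two]
    ring
  rw [this, LeftOf, mul_pos_iff_of_pos_left h0]

lemma add_norm_smul_unitTangent {a b : Plane} (h : a ≠ b) :
    a + ‖b - a‖ • unitTangent a b = b := by
  have : ‖b - a‖ ≠ 0 := norm_ne_zero_iff.2 (sub_ne_zero.2 h.symm)
  rw [unitTangent, smul_inv_smul₀ this]; abel

namespace PolygonalDomain

variable (P : PolygonalDomain)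

/-- The length of edge `k`. -/
def length (k : Fin P.K) : ℝ := ‖P.vertex (P.next k) - P.vertex k‖

/-- The arc length parametrization of the line through edge `k`. -/
def param (k : Fin P.K) (s : ℝ) : Plane := P.vertex k + s • P.tangent k

variable {P}

lemma vertex_ne (k : Fin P.K) : P.vertex k ≠ P.vertex (P.next k) :=
  fun h => P.next_ne k (P.vertex_injective h).symm

lemma length_pos (k : Fin P.K) : 0 < P.length k :=
  norm_pos_iff.2 (sub_ne_zero.2 (vertex_ne k).symm)

lemma norm_tangent (k : Fin P.K) : ‖P.tangent k‖ = 1 := norm_unitTangent (vertex_ne k)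

lemma norm_normal (k : Fin P.K) : ‖P.normal k‖ = 1 := norm_unitNormal (vertex_ne k)

lemma inner_tangent_normal (k : Fin P.K) : inner ℝ (P.tangent k) (P.normal k) = 0 :=
  inner_unitTangent_unitNormal _ _

lemma normal_zero (k : Fin P.K) : P.normal k 0 = P.tangent k 1 := by
  simp [normal, tangent, unitNormal]

lemma normal_one (k : Fin P.K) : P.normal k 1 = - P.tangent k 0 := by
  simp [normal, tangent, unitNormal]

@[simp] lemma param_zero (k : Fin P.K) : P.param k 0 = P.vertex k := by simp [param]

@[simp] lemma param_length (k : Fin P.K) : P.param k (P.length k) = P.vertex (P.next k) :=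
  add_norm_smul_unitTangent (vertex_ne k)

lemma isometry_param (k : Fin P.K) : Isometry (P.param k) := by
  refine Isometry.of_dist_eq fun s t => ?_
  rw [param, param, dist_eq_norm, dist_eq_norm, add_sub_add_left_eq_sub, ← sub_smul, norm_smul,
    norm_tangent, mul_one]

lemma continuous_param (k : Fin P.K) : Continuous (P.param k) := (isometry_param k).continuous

lemma edge_eq_image (k : Fin P.K) : P.edge k = P.param k '' Ioo 0 (P.length k) := by
  have hl := length_pos k
  rw [edge, openSegment_eq_image']
  have hT : P.vertex (P.next k) - P.vertex k = P.length k • P.tangent k := by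
    rw [← param_length k, param]; abel
  ext x
  simp only [mem_image, mem_Ioo, hT, param]
  constructor
  · rintro ⟨θ, ⟨h0, h1⟩, rfl⟩
    exact ⟨θ * P.length k, ⟨by positivity, by nlinarith⟩, by rw [mul_smul]⟩
  · rintro ⟨s, ⟨h0, h1⟩, rfl⟩
    refine ⟨s / P.length k, ⟨by positivity, (div_lt_one hl).2 h1⟩, ?_⟩
    rw [smul_smul, div_mul_cancel₀ _ hl.ne']

lemma param_mem_edge_iff (k : Fin P.K) (s : ℝ) : P.param k s ∈ P.edge k ↔
    s ∈ Ioo 0 (P.length k) := by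
  rw [edge_eq_image, (isometry_param k).injective.mem_set_image]

lemma measurableEmbedding_param (k : Fin P.K) : MeasurableEmbedding (P.param k) :=
  (isometry_param k).isClosedEmbedding.measurableEmbedding

lemma measurableSet_edge (k : Fin P.K) : MeasurableSet (P.edge k) := by
  rw [edge_eq_image]
  exact (measurableEmbedding_param k).measurableSet_image.2 measurableSet_Ioo

/-- The parametrization is an isometry of the real line, where `μH[1]` is Lebesgue measure, and
isometries preserve Hausdorff measure. -/
lemma restrict_edge_eq_map (k : Fin P.K) :
    (μH[1] : Measure Plane).restrict (P.edge k) =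
      (volume.restrict (Ioo 0 (P.length k))).map (P.param k) := by
  have h1 := (isometry_param k).map_hausdorffMeasure (d := 1) (Or.inl zero_le_one)
  rw [hausdorffMeasure_real] at h1
  have hsub : P.edge k ⊆ range (P.param k) := by
    rw [edge_eq_image]; exact image_subset_range _ _
  have hpre : P.param k ⁻¹' P.edge k = Ioo 0 (P.length k) := by
    ext s; exact param_mem_edge_iff k s
  rw [← hpre, ← (measurableEmbedding_param k).restrict_map, h1,
    Measure.restrict_restrict (measurableSet_edge k), inter_eq_left.2 hsub]

lemma setIntegral_edge (k : Fin P.K) (F : Plane → ℝ) :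
    ∫ x in P.edge k, F x ∂μH[1] = ∫ s in Ioo 0 (P.length k), F (P.param k s) := by
  rw [restrict_edge_eq_map, (measurableEmbedding_param k).integral_map]

instance isFiniteMeasure_edge (k : Fin P.K) :
    IsFiniteMeasure ((μH[1] : Measure Plane).restrict (P.edge k)) := by
  rw [restrict_edge_eq_map]
  infer_instance

lemma segment_subset_frontier (k : Fin P.K) :
    segment ℝ (P.vertex k) (P.vertex (P.next k)) ⊆ frontier P.Ω := by
  rw [P.frontier_eq]
  exact subset_iUnion (fun k => segment ℝ (P.vertex k) (P.vertex (P.next k))) k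

lemma edge_subset_frontier (k : Fin P.K) : P.edge k ⊆ frontier P.Ω :=
  (openSegment_subset_segment ℝ _ _).trans (segment_subset_frontier k)

lemma vertex_mem_frontier (k : Fin P.K) : P.vertex k ∈ frontier P.Ω :=
  segment_subset_frontier k (left_mem_segment ℝ _ _)

lemma edge_subset_closure (k : Fin P.K) : P.edge k ⊆ closure P.Ω \ range P.vertex := by
  refine fun x hx => ⟨frontier_subset_closure (edge_subset_frontier k hx), ?_⟩
  rintro ⟨l, rfl⟩
  exact P.vertex_notMem k l hx

lemma subset_closure_diff : P.Ω ⊆ closure P.Ω \ range P.vertex := by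
  refine fun x hx => ⟨subset_closure hx, ?_⟩
  rintro ⟨l, rfl⟩
  have := vertex_mem_frontier l
  rw [P.isOpen.frontier_eq] at this
  exact this.2 hx

lemma isCompact_closure : IsCompact (closure P.Ω) := P.isBounded.isCompact_closure

lemma isCompact_segment (k : Fin P.K) :
    IsCompact (segment ℝ (P.vertex k) (P.vertex (P.next k))) := by
  rw [segment_eq_image]
  exact isCompact_Icc.image (by fun_prop)

instance isFiniteMeasure_domain : IsFiniteMeasure ((volume : Measure Plane).restrict P.Ω) :=
  ⟨by rw [Measure.restrict_apply_univ]; exact P.isBounded.measure_lt_top⟩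

lemma segment_eq_insert (k : Fin P.K) : segment ℝ (P.vertex k) (P.vertex (P.next k)) =
    insert (P.vertex k) (insert (P.vertex (P.next k)) (P.edge k)) :=
  (insert_endpoints_openSegment ℝ _ _).symm

/-- A point of an open edge lies on no other closed edge. -/
lemma notMem_segment_of_mem_edge {k l : Fin P.K} (hkl : l ≠ k) {x : Plane} (hx : x ∈ P.edge k) :
    x ∉ segment ℝ (P.vertex l) (P.vertex (P.next l)) := by
  rw [segment_eq_insert]
  rintro (rfl | rfl | h)
  · exact P.vertex_notMem k l hx
  · exact P.vertex_notMem k _ hx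
  · exact (P.edges_disjoint k l hkl.symm).le_bot ⟨hx, h⟩

/-- A corner point lies on its two adjacent closed edges only. -/
lemma vertex_notMem_segment {k l : Fin P.K} (h1 : l ≠ k) (h2 : l ≠ P.next k) :
    P.vertex (P.next k) ∉ segment ℝ (P.vertex l) (P.vertex (P.next l)) := by
  rw [segment_eq_insert]
  rintro (h | h | h)
  · exact h2 (P.vertex_injective h).symm
  · exact h1 (P.next.injective (P.vertex_injective h)).symm
  · exact P.vertex_notMem l _ h

lemma frontier_diff_vertices : frontier P.Ω \ range P.vertex ⊆ ⋃ k, P.edge k := by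
  rintro x ⟨hx, hv⟩
  rw [P.frontier_eq] at hx
  obtain ⟨k, hk⟩ := mem_iUnion.1 hx
  rw [segment_eq_insert] at hk
  rcases hk with rfl | rfl | h
  · exact absurd ⟨k, rfl⟩ hv
  · exact absurd ⟨_, rfl⟩ hv
  · exact mem_iUnion.2 ⟨k, h⟩

end PolygonalDomain

open PolygonalDomain

/-- `g` is bounded and continuous on the closed domain except for the corner points, and it has the
bounded continuous derivative `g'` inside the domain. -/
structure IsBoundedC1 (P : PolygonalDomain) (g : Plane → ℝ) (g' : Plane → Plane →L[ℝ] ℝ) :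
    Prop where
  cont : ContinuousOn g (closure P.Ω \ range P.vertex)
  bdd : ∃ M, ∀ x ∈ closure P.Ω \ range P.vertex, |g x| ≤ M
  deriv : ∀ x ∈ P.Ω, HasFDerivAt g (g' x) x
  cont' : ContinuousOn g' P.Ω
  bdd' : ∃ M, ∀ x ∈ P.Ω, ‖g' x‖ ≤ M

namespace IsBoundedC1

variable {P : PolygonalDomain} {g f : Plane → ℝ} {g' f' : Plane → Plane →L[ℝ] ℝ}

lemma of_isC1UpToBoundary (h : IsC1UpToBoundary P.Ω g) : ∃ g', IsBoundedC1 P g g' := by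
  obtain ⟨hc, g', hc', hd⟩ := h
  obtain ⟨M, hM⟩ := isCompact_closure.exists_bound_of_continuousOn hc
  obtain ⟨M', hM'⟩ := isCompact_closure.exists_bound_of_continuousOn hc'
  exact ⟨g', hc.mono sdiff_subset, ⟨M, fun x hx => hM x hx.1⟩, hd, hc'.mono subset_closure,
    ⟨M', fun x hx => hM' x (subset_closure hx)⟩⟩

lemma of_contDiff (h : ContDiff ℝ 1 g) : IsBoundedC1 P g (fderiv ℝ g) := by
  obtain ⟨M, hM⟩ := (isCompact_closure (P := P)).exists_bound_of_continuousOn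
    h.continuous.continuousOn
  obtain ⟨M', hM'⟩ := (isCompact_closure (P := P)).exists_bound_of_continuousOn
    (h.continuous_fderiv one_ne_zero).continuousOn
  exact ⟨h.continuous.continuousOn, ⟨M, fun x hx => hM x hx.1⟩,
    fun x _ => (h.differentiable one_ne_zero x).hasFDerivAt,
    (h.continuous_fderiv one_ne_zero).continuousOn,
    ⟨M', fun x hx => hM' x (subset_closure hx)⟩⟩

lemma cont_domain (h : IsBoundedC1 P g g') : ContinuousOn g P.Ω := h.cont.mono subset_closure_diff

lemma mul (h : IsBoundedC1 P g g') (k : IsBoundedC1 P f f') :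
    IsBoundedC1 P (fun x => g x * f x) (fun x => g x • f' x + f x • g' x) := by
  obtain ⟨M, hM⟩ := h.bdd
  obtain ⟨M', hM'⟩ := h.bdd'
  obtain ⟨K, hK⟩ := k.bdd
  obtain ⟨K', hK'⟩ := k.bdd'
  refine ⟨h.cont.mul k.cont, ⟨M * K, fun x hx => ?_⟩, fun x hx => (h.deriv x hx).mul (k.deriv x hx),
    (h.cont_domain.smul k.cont').add (k.cont_domain.smul h.cont'),
    ⟨M * K' + K * M', fun x hx => ?_⟩⟩
  · rw [abs_mul]
    exact mul_le_mul (hM x hx) (hK x hx) (abs_nonneg _) ((abs_nonneg _).trans (hM x hx))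
  · have hx' := subset_closure_diff hx
    refine (norm_add_le _ _).trans ?_
    rw [norm_smul, norm_smul, Real.norm_eq_abs, Real.norm_eq_abs]
    exact add_le_add
      (mul_le_mul (hM x hx') (hK' x hx) (norm_nonneg _) ((abs_nonneg _).trans (hM x hx')))
      (mul_le_mul (hK x hx') (hM' x hx) (norm_nonneg _) ((abs_nonneg _).trans (hK x hx')))

lemma add (h : IsBoundedC1 P g g') (k : IsBoundedC1 P f f') :
    IsBoundedC1 P (fun x => g x + f x) (fun x => g' x + f' x) := by
  obtain ⟨M, hM⟩ := h.bdd
  obtain ⟨M', hM'⟩ := h.bdd'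
  obtain ⟨K, hK⟩ := k.bdd
  obtain ⟨K', hK'⟩ := k.bdd'
  exact ⟨h.cont.add k.cont, ⟨M + K, fun x hx =>
    (abs_add_le _ _).trans (add_le_add (hM x hx) (hK x hx))⟩,
    fun x hx => (h.deriv x hx).add (k.deriv x hx), h.cont'.add k.cont', ⟨M' + K', fun x hx =>
    (norm_add_le _ _).trans (add_le_add (hM' x hx) (hK' x hx))⟩⟩

lemma const (c : ℝ) : IsBoundedC1 P (fun _ => c) (fun _ => 0) := by
  have := of_contDiff (P := P) (contDiff_const (𝕜 := ℝ) (c := c))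
  convert this using 2
  simp

lemma sum {ι : Type*} (s : Finset ι) {g : ι → Plane → ℝ} {g' : ι → Plane → Plane →L[ℝ] ℝ}
    (h : ∀ i ∈ s, IsBoundedC1 P (g i) (g' i)) :
    IsBoundedC1 P (fun x => ∑ i ∈ s, g i x) (fun x => ∑ i ∈ s, g' i x) := by
  classical
  induction s using Finset.induction_on with
  | empty => simpa using const 0
  | insert i s hi ih =>
    simp only [Finset.sum_insert hi]
    exact (h i (Finset.mem_insert_self _ _)).add
      (ih fun j hj => h j (Finset.mem_insert_of_mem hj))

lemma integrableOn_deriv (h : IsBoundedC1 P g g') (w : Plane) :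
    IntegrableOn (fun x => g' x w) P.Ω := by
  obtain ⟨M', hM'⟩ := h.bdd'
  refine ⟨(h.cont'.clm_apply continuousOn_const).aestronglyMeasurable P.isOpen.measurableSet,
    HasFiniteIntegral.restrict_of_bounded (C := M' * ‖w‖) P.isBounded.measure_lt_top ?_⟩
  rw [ae_restrict_iff' P.isOpen.measurableSet]
  refine ae_of_all _ fun x hx => (ContinuousLinearMap.le_opNorm _ _).trans ?_
  gcongr
  exact hM' x hx

lemma memLp_edge (h : IsBoundedC1 P g g') (k : Fin P.K) (p : ℝ≥0∞) :
    MemLp g p ((μH[1] : Measure Plane).restrict (P.edge k)) := by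
  obtain ⟨M, hM⟩ := h.bdd
  refine MemLp.of_bound ((h.cont.mono (edge_subset_closure k)).aestronglyMeasurable
    (measurableSet_edge k)) M ?_
  rw [ae_restrict_iff' (measurableSet_edge k)]
  exact ae_of_all _ fun x hx => hM x (edge_subset_closure k hx)

lemma integrableOn_edge (h : IsBoundedC1 P g g') (k : Fin P.K) :
    IntegrableOn g (P.edge k) μH[1] :=
  memLp_one_iff_integrable.1 (h.memLp_edge k 1)

end IsBoundedC1

end

/-! ### The Gauss theorem near a point that is not a corner -/

section

open PolygonalDomain

/-- The Gauss theorem holds for the function `g` with derivative `g'`. -/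
def GaussFormula (P : PolygonalDomain) (g : Plane → ℝ) (g' : Plane → Plane →L[ℝ] ℝ) : Prop :=
  ∀ w : Plane, ∫ x in P.Ω, g' x w =
    ∑ k, inner ℝ (P.normal k) w * ∫ x in P.edge k, g x ∂μH[1]

variable {P : PolygonalDomain} {g : Plane → ℝ} {g' : Plane → Plane →L[ℝ] ℝ}

/-- Inside the ball the domain is a half plane, and outside it the cutoff makes `χ * g` zero
whatever `g` does there. So `χ * g` is regular enough on the whole half plane for `gauss_halfPlane`.
The point `z` fixes the boundary line and may lie outside the ball. -/
lemma integral_deriv_of_local_halfPlane (hg : IsBoundedC1 P g g') {T ν : Plane} (hT : ‖T‖ = 1)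
    (hν : ‖ν‖ = 1) (hTν : inner ℝ T ν = 0) (z x₀ : Plane) {r : ℝ} (hr : 0 < r)
    (hΩ : ∀ y ∈ Metric.ball x₀ r, y ∈ P.Ω ↔ 0 < inner ℝ ν (y - z))
    (hcl : ∀ y ∈ Metric.ball x₀ r, 0 ≤ inner ℝ ν (y - z) → y ∈ closure P.Ω \ range P.vertex)
    {χ : Plane → ℝ} (hχ : ContDiff ℝ ∞ χ) (hs : tsupport χ ⊆ Metric.ball x₀ r) (w : Plane) :
    ∫ x in P.Ω, (χ x • g' x + g x • fderiv ℝ χ x) w =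
      - inner ℝ ν w * ∫ s : ℝ, χ (z + s • T) * g (z + s • T) := by
  have hχ1 : ContDiff ℝ 1 χ := hχ.of_le (by simp)
  have hm := (IsBoundedC1.of_contDiff (P := P) hχ1).mul hg
  obtain ⟨M, hM⟩ := hm.bdd'
  have hM0 : 0 ≤ max M 0 := le_max_right _ _
  have hzero : ∀ y, y ∉ tsupport χ → χ =ᶠ[𝓝 y] 0 := fun y hy => notMem_tsupport_iff_eventuallyEq.1 hy
  have hD0 : ∀ y, y ∉ tsupport χ → χ y • g' y + g y • fderiv ℝ χ y = 0 := by
    intro y hy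
    rw [(hzero y hy).fderiv_eq, (hzero y hy).eq_of_nhds]; simp
  -- The support is measured from `z` instead of `x₀`, hence the enlarged radius. The bound `max M
  -- 0` also covers the points where the derivative is zero.
  have key := gauss_halfPlane (R := r + ‖x₀ - z‖) (h := fun x => χ x * g x)
    (h' := fun x => χ x • g' x + g x • fderiv ℝ χ x) (M := max M 0) hT hν hTν z (by positivity)
    ?_ ?_ ?_ ?_ ?_ ?_ w
  · rw [← key]
    set F : Plane → ℝ := fun x => (χ x • g' x + g x • fderiv ℝ χ x) w
    have hF : ∀ y, y ∉ Metric.ball x₀ r → F y = 0 := by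
      intro y hy
      have := hD0 y (fun h => hy (hs h))
      simp only [F, this]; rfl
    have hH : MeasurableSet {y : Plane | 0 < inner ℝ ν (y - z)} :=
      (isOpen_lt continuous_const (by fun_prop)).measurableSet
    rw [setIntegral_eq_of_subset_of_forall_sdiff_eq_zero P.isOpen.measurableSet
        (s := P.Ω ∩ Metric.ball x₀ r) inter_subset_left
        (fun y hy => hF y fun h => hy.2 ⟨hy.1, h⟩),
      setIntegral_eq_of_subset_of_forall_sdiff_eq_zero hH
        (s := {y : Plane | 0 < inner ℝ ν (y - z)} ∩ Metric.ball x₀ r) inter_subset_left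
        (fun y hy => hF y fun h => hy.2 ⟨hy.1, h⟩)]
    congr 2
    ext y
    simp only [mem_inter_iff, mem_ofPred_eq]
    exact and_congr_left fun h => hΩ y h
  · intro y hy
    by_cases hyb : y ∈ tsupport χ
    · have hyb := hs hyb
      refine (hχ.continuous.continuousAt.continuousWithinAt).mul ?_
      have h1 : ContinuousWithinAt g (closure P.Ω \ range P.vertex) y := hg.cont y (hcl y hyb hy)
      refine h1.mono_of_mem_nhdsWithin ?_
      rw [mem_nhdsWithin]
      exact ⟨_, Metric.isOpen_ball, hyb, fun u hu => hcl u hu.1 hu.2⟩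
    · refine ContinuousAt.continuousWithinAt ?_
      have : (fun x => χ x * g x) =ᶠ[𝓝 y] fun _ => 0 := by
        filter_upwards [hzero y hyb] with u hu
        simp [hu]
      exact continuousAt_const.congr this.symm
  · intro y hy
    by_cases hyb : y ∈ tsupport χ
    · exact hm.deriv y ((hΩ y (hs hyb)).2 hy)
    · have : (fun x => χ x * g x) =ᶠ[𝓝 y] fun _ => 0 := by
        filter_upwards [hzero y hyb] with u hu
        simp [hu]
      rw [hD0 y hyb]
      exact (hasFDerivAt_const (0 : ℝ) y).congr_of_eventuallyEq this
  · intro y hy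
    refine ContinuousAt.continuousWithinAt ?_
    by_cases hyb : y ∈ tsupport χ
    · exact hm.cont'.continuousAt (P.isOpen.mem_nhds ((hΩ y (hs hyb)).2 hy))
    · have : (fun x => χ x • g' x + g x • fderiv ℝ χ x) =ᶠ[𝓝 y] fun _ => 0 := by
        filter_upwards [(isClosed_tsupport χ).isOpen_compl.mem_nhds hyb] with u hu
        exact hD0 u hu
      exact continuousAt_const.congr this.symm
  · intro y hy
    by_cases hyb : y ∈ tsupport χ
    · exact (hM y ((hΩ y (hs hyb)).2 hy)).trans (le_max_left _ _)
    · simp only [hD0 y hyb, norm_zero, hM0]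
  all_goals
    intro y hy
    have hyb : y ∉ tsupport χ := by
      intro h
      have h1 := mem_ball_iff_norm.1 (hs h)
      have h2 : ‖y - z‖ ≤ ‖y - x₀‖ + ‖x₀ - z‖ := by
        have : y - z = (y - x₀) + (x₀ - z) := by abel
        rw [this]; exact norm_add_le _ _
      linarith
  · simp [(hzero y hyb).eq_of_nhds]
  · exact hD0 y hyb

/-- The Gauss theorem for functions supported near a given point that is not a corner. -/
lemma exists_ball_gaussFormula {x₀ : Plane} (hx₀ : x₀ ∈ closure P.Ω \ range P.vertex) :
    ∃ r > 0, ∀ χ : Plane → ℝ, ContDiff ℝ ∞ χ → tsupport χ ⊆ Metric.ball x₀ r →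
      ∀ g g', IsBoundedC1 P g g' →
        GaussFormula P (fun x => χ x * g x) (fun x => χ x • g' x + g x • fderiv ℝ χ x) := by
  by_cases hin : x₀ ∈ P.Ω
  · obtain ⟨r, hr, hball⟩ := Metric.isOpen_iff.1 P.isOpen x₀ hin
    refine ⟨r, hr, fun χ hχ hs g g' hg w => ?_⟩
    have hT : ‖(EuclideanSpace.single 0 1 : Plane)‖ = 1 := by simp
    have hν : ‖(EuclideanSpace.single 1 1 : Plane)‖ = 1 := by simp
    have hTν : inner ℝ (EuclideanSpace.single 0 1 : Plane) (EuclideanSpace.single 1 1) = 0 := by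
      simp [PiLp.inner_apply]
    set ν : Plane := EuclideanSpace.single 1 1
    -- An artificial half plane whose boundary line has distance `2 * r` from `x₀`. The ball lies
    -- strictly inside, so the interior case is an instance of the half plane case without boundary
    -- term.
    set z : Plane := x₀ - (2 * r) • ν with hz
    have hpos : ∀ y ∈ Metric.ball x₀ r, 0 < inner ℝ ν (y - z) := by
      intro y hy
      have h1 : y - z = (y - x₀) + (2 * r) • ν := by rw [hz]; abel
      have h2 := abs_le.1 (abs_real_inner_le_norm ν (y - x₀))
      rw [hν, one_mul] at h2
      have h3 := mem_ball_iff_norm.1 hy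
      rw [h1, inner_add_right, inner_smul_right, real_inner_self_eq_norm_sq, hν]
      linarith
    rw [integral_deriv_of_local_halfPlane hg hT hν hTν z x₀ hr
      (fun y hy => ⟨fun _ => hpos y hy, fun _ => hball hy⟩)
      (fun y hy _ => subset_closure_diff (hball hy)) hχ hs w]
    have h0 : ∀ s : ℝ, χ (z + s • EuclideanSpace.single 0 1) = 0 := by
      intro s
      by_contra hne
      have := hpos _ (hs (subset_tsupport _ hne))
      simp only [add_sub_cancel_left, inner_smul_right] at this
      rw [real_inner_comm, hTν] at this
      simp at this
    simp only [h0, zero_mul, integral_zero, mul_zero]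
    refine (Finset.sum_eq_zero fun k _ => ?_).symm
    rw [setIntegral_eq_zero_of_forall_eq_zero, mul_zero]
    intro x hx
    have : χ x = 0 := by
      by_contra hne
      have h1 := edge_subset_frontier k hx
      rw [P.isOpen.frontier_eq] at h1
      exact h1.2 (hball (hs (subset_tsupport _ hne)))
    rw [this, zero_mul]
  · have hfr : x₀ ∈ frontier P.Ω := by rw [P.isOpen.frontier_eq]; exact ⟨hx₀.1, hin⟩
    obtain ⟨k, hk⟩ := mem_iUnion.1 (frontier_diff_vertices ⟨hfr, hx₀.2⟩)
    obtain ⟨r₁, hr₁, hloc⟩ := P.edge_local k x₀ hk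
    -- A ball avoiding this closed set meets no other edge and no corner.
    have hcl : IsClosed ((⋃ l ∈ {l | l ≠ k}, segment ℝ (P.vertex l) (P.vertex (P.next l))) ∪
        range P.vertex) :=
      ((toFinite _).isClosed_biUnion fun l _ => (isCompact_segment l).isClosed).union
        (finite_range _).isClosed
    have hnot : x₀ ∈ ((⋃ l ∈ {l | l ≠ k}, segment ℝ (P.vertex l) (P.vertex (P.next l))) ∪
        range P.vertex)ᶜ := by
      rintro (h | h)
      · simp only [mem_iUnion] at h
        obtain ⟨l, hl, h⟩ := h
        exact notMem_segment_of_mem_edge hl hk h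
      · exact hx₀.2 h
    obtain ⟨r₂, hr₂, hball⟩ := Metric.isOpen_iff.1 hcl.isOpen_compl x₀ hnot
    have hr : 0 < min r₁ r₂ := lt_min hr₁ hr₂
    refine ⟨min r₁ r₂, hr, fun χ hχ hs g g' hg w => ?_⟩
    obtain ⟨s₀, hs₀, hxs⟩ : ∃ s₀ ∈ Ioo 0 (P.length k), P.param k s₀ = x₀ := by
      rwa [edge_eq_image] at hk
    have hν : ‖-P.normal k‖ = 1 := by rw [norm_neg, norm_normal]
    have hTν : inner ℝ (P.tangent k) (-P.normal k) = 0 := by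
      rw [inner_neg_right, inner_tangent_normal, neg_zero]
    have hΩ : ∀ y ∈ Metric.ball x₀ (min r₁ r₂),
        y ∈ P.Ω ↔ 0 < inner ℝ (-P.normal k) (y - P.vertex k) := by
      intro y hy
      rw [hloc y (Metric.ball_subset_ball (min_le_left _ _) hy), leftOf_iff_inner (vertex_ne k)]
      rfl
    have hpar : ∀ s, inner ℝ (-P.normal k) (P.param k s - P.vertex k) = 0 := by
      intro s
      rw [param, add_sub_cancel_left, inner_smul_right, real_inner_comm, hTν, mul_zero]
    have hclosure : ∀ y ∈ Metric.ball x₀ (min r₁ r₂),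
        0 ≤ inner ℝ (-P.normal k) (y - P.vertex k) → y ∈ closure P.Ω \ range P.vertex := by
      intro y hy h0
      refine ⟨?_, fun h => hball (Metric.ball_subset_ball (min_le_right _ _) hy) (Or.inr h)⟩
      rw [mem_closure_iff_nhds]
      intro U hU
      -- A small shift along the inner normal stays in the ball and enters the open half plane,
      -- hence the domain.
      have hc : Tendsto (fun ε : ℝ => y + ε • (-P.normal k)) (𝓝[>] 0) (𝓝 y) := by
        have : Continuous (fun ε : ℝ => y + ε • (-P.normal k)) := by fun_prop
        have h := this.tendsto 0
        simp only [zero_smul, add_zero] at h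
        exact h.mono_left nhdsWithin_le_nhds
      obtain ⟨ε, ⟨hεU, hεb⟩, hε⟩ := ((hc.eventually (inter_mem hU
        (Metric.isOpen_ball.mem_nhds hy))).and self_mem_nhdsWithin).exists
      refine ⟨_, hεU, (hΩ _ hεb).2 ?_⟩
      rw [add_sub_right_comm, inner_add_right, inner_smul_right, real_inner_self_eq_norm_sq, hν]
      have hε : 0 < ε := hε
      linarith
    rw [integral_deriv_of_local_halfPlane hg (norm_tangent k) hν hTν (P.vertex k) x₀ hr hΩ
      hclosure hχ hs w]
    rw [Finset.sum_eq_single k]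
    · rw [setIntegral_edge, inner_neg_left, neg_neg]
      congr 1
      refine (setIntegral_eq_integral_of_forall_compl_eq_zero fun s hs' => ?_).symm
      -- A parameter outside the edge with nonzero integrand would give a frontier point in the ball
      -- that is not a corner; it would lie on another edge, against the choice of `r₂`.
      by_contra hne
      have h1 : P.param k s ∈ Metric.ball x₀ (min r₁ r₂) :=
        hs (subset_tsupport _ (left_ne_zero_of_mul hne))
      have h2 := hclosure _ h1 (hpar s).ge
      have h3 : P.param k s ∈ frontier P.Ω := by
        rw [P.isOpen.frontier_eq]
        exact ⟨h2.1, fun h => ((hΩ _ h1).1 h).ne' (hpar s)⟩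
      obtain ⟨l, hl⟩ := mem_iUnion.1 (frontier_diff_vertices ⟨h3, h2.2⟩)
      by_cases hlk : l = k
      · subst hlk
        exact hs' ((param_mem_edge_iff l s).1 hl)
      · refine hball (Metric.ball_subset_ball (min_le_right _ _) h1) (Or.inl ?_)
        exact mem_biUnion hlk (openSegment_subset_segment ℝ _ _ hl)
    · intro l _ hlk
      rw [setIntegral_eq_zero_of_forall_eq_zero, mul_zero]
      intro x hx
      have : χ x = 0 := by
        by_contra hne
        refine hball (Metric.ball_subset_ball (min_le_right _ _) (hs (subset_tsupport _ hne)))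
          (Or.inl ?_)
        exact mem_biUnion hlk (openSegment_subset_segment ℝ _ _ hx)
      rw [this, zero_mul]
    · simp

end

/-! ### The Gauss theorem on the whole domain -/

section

open PolygonalDomain

lemma exists_smooth_partition {ι : Type*} [Fintype ι] {S : Set Plane} (hS : IsClosed S)
    (U : ι → Set Plane) (hU : ∀ i, IsOpen (U i)) (hSU : S ⊆ ⋃ i, U i) :
    ∃ χ : ι → Plane → ℝ, (∀ i, ContDiff ℝ ∞ (χ i)) ∧ (∀ i, tsupport (χ i) ⊆ U i) ∧
      ∀ x ∈ S, ∑ i, χ i x = 1 := by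
  obtain ⟨f, hf⟩ := SmoothPartitionOfUnity.exists_isSubordinate (modelWithCornersSelf ℝ Plane)
    hS U hU hSU
  refine ⟨fun i => f i, fun i => (f i).contMDiff.contDiff, hf, fun x hx => ?_⟩
  rw [← f.sum_eq_one hx, finsum_eq_sum_of_fintype]

variable {P : PolygonalDomain} {g f : Plane → ℝ} {g' f' : Plane → Plane →L[ℝ] ℝ}

lemma IsBoundedC1.deriv_eqOn (hg : IsBoundedC1 P g g') (hf : IsBoundedC1 P f f')
    (h : EqOn f g P.Ω) : EqOn f' g' P.Ω := fun x hx =>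
  ((hf.deriv x hx).congr_of_eventuallyEq
    ((h.symm.eventuallyEq_of_mem (P.isOpen.mem_nhds hx)))).unique (hg.deriv x hx)

lemma GaussFormula.congr (hg : IsBoundedC1 P g g') (hf : IsBoundedC1 P f f')
    (h : EqOn f g (closure P.Ω \ range P.vertex)) (H : GaussFormula P f f') :
    GaussFormula P g g' := by
  intro w
  have h1 := hg.deriv_eqOn hf (h.mono subset_closure_diff)
  rw [← setIntegral_congr_fun P.isOpen.measurableSet (fun x hx => by simp only [h1 hx] :
    EqOn (fun x => f' x w) (fun x => g' x w) P.Ω), H w]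
  refine Finset.sum_congr rfl fun k _ => ?_
  rw [setIntegral_congr_fun (measurableSet_edge k) (h.mono (edge_subset_closure k))]

lemma GaussFormula.sum {ι : Type*} (s : Finset ι) {g : ι → Plane → ℝ}
    {g' : ι → Plane → Plane →L[ℝ] ℝ} (hg : ∀ i ∈ s, IsBoundedC1 P (g i) (g' i))
    (h : ∀ i ∈ s, GaussFormula P (g i) (g' i)) :
    GaussFormula P (fun x => ∑ i ∈ s, g i x) (fun x => ∑ i ∈ s, g' i x) := by
  intro w
  have h1 : ∫ x in P.Ω, (∑ i ∈ s, g' i x) w = ∑ i ∈ s, ∫ x in P.Ω, g' i x w := by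
    simp only [_root_.sum_apply]
    exact integral_finsetSum _ fun i hi => (hg i hi).integrableOn_deriv w
  rw [h1, Finset.sum_congr rfl fun i hi => h i hi w, Finset.sum_comm]
  refine Finset.sum_congr rfl fun k _ => ?_
  rw [integral_finsetSum _ fun i hi => (hg i hi).integrableOn_edge k, Finset.mul_sum]

/-- The Gauss theorem for functions vanishing near the corners. -/
lemma gaussFormula_of_eventually_zero (hg : IsBoundedC1 P g g')
    (h0 : ∀ k, g =ᶠ[𝓝 (P.vertex k)] 0) : GaussFormula P g g' := by
  classical
  -- This set is compact and contains no corner, so finitely many of the local balls cover it.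
  set S := closure P.Ω ∩ tsupport g with hS
  have hSc : IsCompact S := isCompact_closure.inter_right (isClosed_tsupport g)
  have hSV : S ⊆ closure P.Ω \ range P.vertex := by
    rintro x ⟨hx, hx'⟩
    refine ⟨hx, ?_⟩
    rintro ⟨k, rfl⟩
    exact notMem_tsupport_iff_eventuallyEq.2 (h0 k) hx'
  choose! r hr hG using fun x (hx : x ∈ closure P.Ω \ range P.vertex) =>
    exists_ball_gaussFormula hx
  obtain ⟨t, htS, hcov⟩ := hSc.elim_nhds_subcover (fun x => Metric.ball x (r x))
    (fun x hx => Metric.ball_mem_nhds _ (hr x (hSV hx)))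
  obtain ⟨χ, hχ, hχs, hχ1⟩ := exists_smooth_partition hSc.isClosed
    (fun i : t => Metric.ball (i : Plane) (r i)) (fun i => Metric.isOpen_ball) (by
      refine hcov.trans fun x hx => ?_
      simp only [mem_iUnion] at hx ⊢
      obtain ⟨y, hy, hxy⟩ := hx
      exact ⟨⟨y, hy⟩, hxy⟩)
  have hN : ∀ i ∈ Finset.univ, IsBoundedC1 P (fun x => χ i x * g x)
      (fun x => χ i x • g' x + g x • fderiv ℝ (χ i) x) := fun i _ =>
    (IsBoundedC1.of_contDiff ((hχ i).of_le (by simp))).mul hg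
  refine GaussFormula.congr hg (IsBoundedC1.sum _ hN) ?_ (GaussFormula.sum _ hN fun i _ =>
    hG i (hSV (htS i i.2)) (χ i) (hχ i) (hχs i) g g' hg)
  intro x hx
  simp only [← Finset.sum_mul]
  by_cases hxS : x ∈ S
  · rw [hχ1 x hxS, one_mul]
  · have : g x = 0 := by
      by_contra hne
      exact hxS ⟨hx.1, subset_tsupport _ hne⟩
    rw [this, mul_zero]

/-- A fixed smooth bump function, equal to one on the unit disc. -/
def unitBump : ContDiffBump (0 : Plane) := ⟨1, 2, one_pos, one_lt_two⟩

/-- The bump function scaled by `1 / c` and centered at `p`. -/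
def scaledBump (p : Plane) (c : ℝ) (x : Plane) : ℝ := unitBump (c • (x - p))

section scaledBump

variable (p : Plane) (c : ℝ)

lemma contDiff_scaledBump : ContDiff ℝ ∞ (scaledBump p c) :=
  unitBump.contDiff.comp (by fun_prop : ContDiff ℝ ∞ fun x : Plane => c • (x - p))

lemma abs_scaledBump_le_one (x : Plane) : |scaledBump p c x| ≤ 1 := by
  rw [scaledBump, abs_of_nonneg unitBump.nonneg]
  exact unitBump.le_one

lemma scaledBump_eq_one {x : Plane} (h : ‖c • (x - p)‖ ≤ 1) : scaledBump p c x = 1 :=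
  unitBump.one_of_mem_closedBall (by simpa [unitBump] using h)

lemma scaledBump_eq_zero {x : Plane} (h : 2 ≤ ‖c • (x - p)‖) : scaledBump p c x = 0 :=
  unitBump.zero_of_le_dist (by simpa [unitBump] using h)

lemma fderiv_scaledBump (x : Plane) :
    fderiv ℝ (scaledBump p c) x = c • fderiv ℝ unitBump (c • (x - p)) := by
  have h1 : HasFDerivAt (fun y : Plane => c • (y - p)) (c • ContinuousLinearMap.id ℝ Plane) x :=
    ((hasFDerivAt_id x).sub_const p).const_smul c
  have h2 : HasFDerivAt unitBump (fderiv ℝ unitBump (c • (x - p))) (c • (x - p)) :=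
    ((unitBump.contDiff (n := 1)).differentiable one_ne_zero _).hasFDerivAt
  have h3 := (h2.comp x h1).fderiv
  have h4 : (unitBump : Plane → ℝ) ∘ (fun y : Plane => c • (y - p)) = scaledBump p c := rfl
  rw [h4] at h3
  rw [h3]
  ext v; simp

/-- The bump attains its maximum or its minimum at these points. This argument includes the circles
of radius one and two themselves. -/
lemma fderiv_unitBump_eq_zero {y : Plane} (h : ‖y‖ ≤ 1 ∨ 2 ≤ ‖y‖) : fderiv ℝ unitBump y = 0 := by
  rcases h with h | h
  · have hmax : IsLocalMax unitBump y := Eventually.of_forall fun z => by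
      rw [unitBump.one_of_mem_closedBall (x := y) (by simpa [unitBump] using h)]
      exact unitBump.le_one
    exact hmax.fderiv_eq_zero
  · have hmin : IsLocalMin unitBump y := Eventually.of_forall fun z => by
      rw [unitBump.zero_of_le_dist (x := y) (by simpa [unitBump] using h)]
      exact unitBump.nonneg
    exact hmin.fderiv_eq_zero

lemma exists_bound_fderiv_unitBump : ∃ C, 0 ≤ C ∧ ∀ y, ‖fderiv ℝ unitBump y‖ ≤ C := by
  obtain ⟨C, hC⟩ := (unitBump.hasCompactSupport.fderiv (𝕜 := ℝ)).exists_bound_of_continuous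
    ((unitBump.contDiff (n := 1)).continuous_fderiv one_ne_zero)
  exact ⟨C, (norm_nonneg _).trans (hC 0), hC⟩

end scaledBump

lemma measureReal_closedBall_div (p : Plane) {c : ℝ} (hc : 0 < c) :
    volume.real (Metric.closedBall p (2 / c)) =
      4 / c ^ 2 * volume.real (Metric.ball (0 : Plane) 1) := by
  have h : 0 ≤ 2 / c := by positivity
  rw [Measure.real, Measure.addHaar_closedBall _ _ h, ENNReal.toReal_mul, finrank_euclideanSpace,
    ENNReal.toReal_ofReal (by positivity), Fintype.card_fin]
  rw [div_pow, Measure.real]; norm_num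

/-- Dominated convergence: the bumps are bounded by one and eventually vanish at every point except
`p`, which is a null set for arc length. -/
lemma tendsto_integral_scaledBump_mul_edge (hg : IsBoundedC1 P g g') (k : Fin P.K) (p : Plane) :
    Tendsto (fun n : ℕ => ∫ x in P.edge k, scaledBump p n x * g x ∂μH[1]) atTop (𝓝 0) := by
  obtain ⟨M, hM⟩ := hg.bdd
  have hz : ∫ x in P.edge k, (0 : ℝ) ∂(μH[1] : Measure Plane) = 0 := integral_zero _ _
  rw [← hz]
  refine tendsto_integral_of_dominated_convergence (fun _ => M) (fun n => ?_)
    (integrable_const _) (fun n => ?_) ?_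
  · exact ((contDiff_scaledBump p n).continuous.continuousOn.mul
      (hg.cont.mono (edge_subset_closure k))).aestronglyMeasurable (measurableSet_edge k)
  · rw [ae_restrict_iff' (measurableSet_edge k)]
    refine ae_of_all _ fun x hx => ?_
    have h1 := hM x (edge_subset_closure k hx)
    rw [Real.norm_eq_abs, abs_mul]
    exact (mul_le_of_le_one_left (abs_nonneg _) (abs_scaledBump_le_one _ _ _)).trans h1
  · have hp : ∀ᵐ x ∂(μH[1] : Measure Plane).restrict (P.edge k), x ≠ p := by
      refine ae_restrict_of_ae ?_
      have := Measure.nullSingletonClass_hausdorff Plane (d := 1) one_pos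
      rw [ae_iff]
      simp
    filter_upwards [hp] with x hx
    have hpos : 0 < ‖x - p‖ := norm_pos_iff.2 (sub_ne_zero.2 hx)
    obtain ⟨n₀, hn₀⟩ := exists_nat_ge (2 / ‖x - p‖)
    refine tendsto_const_nhds.congr' ?_
    filter_upwards [eventually_ge_atTop n₀] with n hn
    rw [scaledBump_eq_zero, zero_mul]
    rw [norm_smul, Real.norm_natCast]
    have : (n₀ : ℝ) ≤ n := Nat.cast_le.2 hn
    rw [← div_le_iff₀ hpos]
    linarith

/-- The gradient of the bump is of order `n`, but its support is a disc of area of order `1 / n ^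
2`, so the integral is of order `1 / n`. -/
lemma tendsto_integral_deriv_scaledBump_mul (hg : IsBoundedC1 P g g') (p w : Plane) :
    Tendsto (fun n : ℕ => ∫ x in P.Ω,
      (scaledBump p n x • g' x + g x • fderiv ℝ (scaledBump p n) x) w) atTop (𝓝 0) := by
  obtain ⟨M, hM⟩ := hg.bdd
  obtain ⟨M', hM'⟩ := hg.bdd'
  obtain ⟨C, hC0, hC⟩ := exists_bound_fderiv_unitBump
  set V := volume.real (Metric.ball (0 : Plane) 1)
  have hbound : ∀ n : ℕ, 0 < n → ‖∫ x in P.Ω,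
      (scaledBump p n x • g' x + g x • fderiv ℝ (scaledBump p n) x) w‖ ≤
      ((max M' 0 + max M 0 * (n * C)) * ‖w‖) * (4 / (n : ℝ) ^ 2 * V) := by
    intro n hn
    have hn' : (0 : ℝ) < n := Nat.cast_pos.2 hn
    rw [← measureReal_closedBall_div p hn', setIntegral_eq_of_subset_of_forall_sdiff_eq_zero
      P.isOpen.measurableSet (s := P.Ω ∩ Metric.closedBall p (2 / n)) inter_subset_left]
    · refine (norm_setIntegral_le_of_norm_le_const
        (C := (max M' 0 + max M 0 * (n * C)) * ‖w‖) ?_ ?_).trans ?_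
      · exact (measure_mono inter_subset_right).trans_lt
          (isCompact_closedBall p (2 / (n : ℝ))).measure_lt_top
      · rintro x ⟨hx, -⟩
        refine (ContinuousLinearMap.le_opNorm _ _).trans ?_
        gcongr
        refine (norm_add_le _ _).trans (add_le_add ?_ ?_)
        · rw [norm_smul]
          exact (mul_le_of_le_one_left (norm_nonneg _) (abs_scaledBump_le_one _ _ _)).trans
            ((hM' x hx).trans (le_max_left _ _))
        · rw [norm_smul, fderiv_scaledBump, norm_smul, Real.norm_natCast]
          gcongr
          · exact (hM x (subset_closure_diff hx)).trans (le_max_left _ _)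
          · exact hC _
      · gcongr
        · exact (isCompact_closedBall p (2 / (n : ℝ))).measure_lt_top.ne
        · exact inter_subset_right
    · rintro x ⟨hx, hx'⟩
      have h2 : 2 ≤ ‖(n : ℝ) • (x - p)‖ := by
        rw [norm_smul, Real.norm_natCast, mul_comm, ← div_le_iff₀ hn', ← dist_eq_norm]
        by_contra! h
        exact hx' ⟨hx, h.le⟩
      rw [scaledBump_eq_zero p _ h2, fderiv_scaledBump, fderiv_unitBump_eq_zero (Or.inr h2)]
      simp
  refine squeeze_zero_norm' ((eventually_gt_atTop 0).mono hbound) ?_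
  have h1 : Tendsto (fun n : ℕ => ((n : ℝ))⁻¹) atTop (𝓝 0) := tendsto_inv_atTop_nhds_zero_nat
  have h2 : Tendsto (fun n : ℕ => max M' 0 * ‖w‖ * 4 * V * ((n : ℝ)⁻¹ * (n : ℝ)⁻¹) +
      max M 0 * C * ‖w‖ * 4 * V * (n : ℝ)⁻¹) atTop (𝓝 0) := by
    simpa using ((h1.mul h1).const_mul (max M' 0 * ‖w‖ * 4 * V)).add
      (h1.const_mul (max M 0 * C * ‖w‖ * 4 * V))
  refine h2.congr' ?_
  filter_upwards [eventually_gt_atTop 0] with n hn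
  have hn' : (n : ℝ) ≠ 0 := (Nat.cast_pos.2 hn).ne'
  field_simp

/-- The Gauss theorem on a polygonal domain. -/
theorem gaussFormula (hg : IsBoundedC1 P g g') : GaussFormula P g g' := by
  classical
  -- The set `B` collects the corners near which `g` is not known to vanish; each induction step
  -- cuts out one of them.
  suffices H : ∀ (B : Finset (Fin P.K)) (g : Plane → ℝ) (g' : Plane → Plane →L[ℝ] ℝ),
      IsBoundedC1 P g g' → (∀ k ∉ B, g =ᶠ[𝓝 (P.vertex k)] 0) → GaussFormula P g g' from
    H Finset.univ g g' hg fun k hk => absurd (Finset.mem_univ k) hk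
  intro B
  induction B using Finset.induction_on with
  | empty =>
    exact fun g g' hg h0 => gaussFormula_of_eventually_zero hg fun k => h0 k (Finset.notMem_empty k)
  | insert l B hl ih =>
    intro g g' hg h0 w
    set p := P.vertex l
    have hc : ∀ n : ℕ, ContDiff ℝ 1 (scaledBump p n) := fun n =>
      (contDiff_scaledBump p n).of_le (by simp)
    have hb : ∀ n : ℕ, IsBoundedC1 P (scaledBump p n) (fderiv ℝ (scaledBump p n)) := fun n =>
      IsBoundedC1.of_contDiff (hc n)
    have hcg := fun n => (hb n).mul hg
    -- This is `(1 - scaledBump p n) * g`, which vanishes near `p` and keeps the zeros of `g` at the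
    -- other corners.
    have hcomp : ∀ n : ℕ, IsBoundedC1 P (fun x => g x + (-1) * (scaledBump p n x * g x)) _ :=
      fun n => hg.add ((IsBoundedC1.const (-1)).mul (hcg n))
    have hgauss : ∀ n : ℕ, 0 < n → ∫ x in P.Ω, g' x w -
        (scaledBump p n x • g' x + g x • fderiv ℝ (scaledBump p n) x) w =
        ∑ k, inner ℝ (P.normal k) w * ∫ x in P.edge k, (g x - scaledBump p n x * g x) ∂μH[1] := by
      intro n hn
      have := ih _ _ (hcomp n) ?_ w
      · simpa [sub_eq_add_neg, add_comm, add_left_comm] using this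
      · intro k hk
        by_cases hkl : k = l
        · subst hkl
          have hn' : (0 : ℝ) < n := Nat.cast_pos.2 hn
          filter_upwards [Metric.ball_mem_nhds (P.vertex k) (inv_pos.2 hn')] with x hx
          rw [scaledBump_eq_one]
          · simp
          · rw [norm_smul, Real.norm_natCast, ← dist_eq_norm]
            rw [Metric.mem_ball] at hx
            calc (n : ℝ) * dist x p ≤ n * (n : ℝ)⁻¹ := by gcongr
              _ = 1 := mul_inv_cancel₀ hn'.ne'
        · filter_upwards [h0 k (by simp [hk, hkl])] with x hx
          simp [hx]
    have h1 : Tendsto (fun n : ℕ => ∫ x in P.Ω, g' x w -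
        (scaledBump p n x • g' x + g x • fderiv ℝ (scaledBump p n) x) w) atTop
        (𝓝 (∫ x in P.Ω, g' x w)) := by
      have := (tendsto_integral_deriv_scaledBump_mul hg p w).const_sub (∫ x in P.Ω, g' x w)
      rw [sub_zero] at this
      refine this.congr fun n => ?_
      rw [integral_sub (hg.integrableOn_deriv w) ((hcg n).integrableOn_deriv w)]
    have h2 : Tendsto (fun n : ℕ => ∑ k, inner ℝ (P.normal k) w *
        ∫ x in P.edge k, (g x - scaledBump p n x * g x) ∂μH[1]) atTop
        (𝓝 (∑ k, inner ℝ (P.normal k) w * ∫ x in P.edge k, g x ∂μH[1])) := by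
      refine tendsto_finsetSum _ fun k _ => Tendsto.const_mul _ ?_
      have := (tendsto_integral_scaledBump_mul_edge hg k p).const_sub (∫ x in P.edge k, g x ∂μH[1])
      rw [sub_zero] at this
      refine this.congr fun n => ?_
      rw [integral_sub (hg.integrableOn_edge k) ((hcg n).integrableOn_edge k)]
    refine tendsto_nhds_unique h1 (h2.congr' ?_)
    filter_upwards [eventually_gt_atTop 0] with n hn
    exact (hgauss n hn).symm

end

/-! ### Integration by parts for Sobolev functions and tangential derivatives -/

section

open PolygonalDomain

section L2

variable {α : Type*} [MeasurableSpace α] {μ : Measure α} {u b : α → ℝ}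

lemma abs_integral_mul_le (hu : MemLp u 2 μ) (hb : MemLp b 2 μ) :
    |∫ x, u x * b x ∂μ| ≤ √(∫ x, u x ^ 2 ∂μ) * √(∫ x, b x ^ 2 ∂μ) := by
  have h2 : ENNReal.ofReal 2 = 2 := by simp
  have h := integral_mul_norm_le_Lp_mul_Lq Real.HolderConjugate.two_two (h2 ▸ hu) (h2 ▸ hb)
  have h1 : |∫ x, u x * b x ∂μ| ≤ ∫ x, ‖u x‖ * ‖b x‖ ∂μ := by
    simpa only [norm_mul, Real.norm_eq_abs] using norm_integral_le_integral_norm (μ := μ)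
      (fun x => u x * b x)
  refine h1.trans (h.trans_eq ?_)
  simp [Real.sqrt_eq_rpow]

lemma tendsto_integral_mul {f : ℕ → α → ℝ} (hu : MemLp u 2 μ) (hf : ∀ n, MemLp (f n) 2 μ)
    (hb : MemLp b 2 μ) (h : Tendsto (fun n => eLpNorm (f n - u) 2 μ) atTop (𝓝 0)) :
    Tendsto (fun n => ∫ x, f n x * b x ∂μ) atTop (𝓝 (∫ x, u x * b x ∂μ)) := by
  refine tendsto_integral_of_L1' _ (hu.integrable_mul hb).1
    (Eventually.of_forall fun n => (hf n).integrable_mul hb) ?_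
  have hle : ∀ n, eLpNorm ((fun x => f n x * b x) - fun x => u x * b x) 1 μ ≤
      eLpNorm (f n - u) 2 μ * eLpNorm b 2 μ := by
    intro n
    have := eLpNorm_smul_le_mul_eLpNorm (p := 2) (q := 2) (r := 1) hb.1 ((hf n).sub hu).1
    convert this using 2
    ext x; simp [sub_mul]
  refine tendsto_of_tendsto_of_tendsto_of_le_of_le tendsto_const_nhds ?_ (fun _ => zero_le) hle
  simpa using ENNReal.Tendsto.mul_const h (Or.inr hb.eLpNorm_ne_top)

end L2

/-- The standard unit vectors. -/
abbrev unitVec (j : Fin 2) : Plane := EuclideanSpace.single j 1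

lemma inner_unitVec (v : Plane) (j : Fin 2) : inner ℝ v (unitVec j) = v j := by
  simp [unitVec, EuclideanSpace.inner_single_right]

lemma partialDeriv_eq (i : Fin 2) (φ : Plane → ℝ) (x : Plane) :
    partialDeriv i φ x = fderiv ℝ φ x (unitVec i) := rfl

lemma contDiff_partialDeriv {φ : Plane → ℝ} (h : ContDiff ℝ ∞ φ) (i : Fin 2) :
    ContDiff ℝ ∞ (partialDeriv i φ) :=
  (h.fderiv_right (m := ∞) (by simp)).clm_apply contDiff_const

lemma tsupport_partialDeriv_subset (φ : Plane → ℝ) (i : Fin 2) :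
    tsupport (partialDeriv i φ) ⊆ tsupport φ :=
  tsupport_fderiv_apply_subset ℝ _

lemma partialDeriv_comm {φ : Plane → ℝ} (h : ContDiff ℝ ∞ φ) (i j : Fin 2) (x : Plane) :
    partialDeriv i (partialDeriv j φ) x = partialDeriv j (partialDeriv i φ) x := by
  have key : ∀ i j, partialDeriv i (partialDeriv j φ) x =
      fderiv ℝ (fderiv ℝ φ) x (unitVec i) (unitVec j) := by
    intro i j
    have hd : HasFDerivAt (fderiv ℝ φ) (fderiv ℝ (fderiv ℝ φ) x) x :=
      ((h.fderiv_right (m := ∞) (by simp)).differentiable (by simp) x).hasFDerivAt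
    have := (hd.clm_apply (hasFDerivAt_const (unitVec j) x)).fderiv
    have h2 : partialDeriv j φ = fun y => fderiv ℝ φ y (unitVec j) := rfl
    rw [partialDeriv_eq, h2, this]
    simp
  rw [key, key]
  exact h.contDiffAt.isSymmSndFDerivAt (n := ∞) (by
    rw [minSmoothness_of_isRCLikeNormedField]; exact WithTop.coe_le_coe.2 (le_top (a := (2 : ℕ∞)))) _ _

variable {P : PolygonalDomain} {g : Plane → ℝ} {g' : Plane → Plane →L[ℝ] ℝ}

namespace IsBoundedC1

lemma memLp_domain (hg : IsBoundedC1 P g g') : MemL2 P.Ω g := by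
  obtain ⟨M, hM⟩ := hg.bdd
  refine MemLp.of_bound (hg.cont_domain.aestronglyMeasurable P.isOpen.measurableSet) M ?_
  rw [ae_restrict_iff' P.isOpen.measurableSet]
  exact ae_of_all _ fun x hx => hM x (subset_closure_diff hx)

lemma memLp_deriv (hg : IsBoundedC1 P g g') (w : Plane) : MemL2 P.Ω (fun x => g' x w) := by
  obtain ⟨M, hM⟩ := hg.bdd'
  refine MemLp.of_bound ((hg.cont'.clm_apply continuousOn_const).aestronglyMeasurable
    P.isOpen.measurableSet) (M * ‖w‖) ?_
  rw [ae_restrict_iff' P.isOpen.measurableSet]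
  refine ae_of_all _ fun x hx => (ContinuousLinearMap.le_opNorm _ _).trans ?_
  gcongr
  exact hM x hx

end IsBoundedC1

lemma isBoundedC1_of_smooth {φ : Plane → ℝ} (h : ContDiff ℝ ∞ φ) :
    IsBoundedC1 P φ (fderiv ℝ φ) := IsBoundedC1.of_contDiff (h.of_le (by simp))

lemma memL2_of_smooth {φ : Plane → ℝ} (h : ContDiff ℝ ∞ φ) : MemL2 P.Ω φ :=
  (isBoundedC1_of_smooth h).memLp_domain

lemma restrict_edge_le (k : Fin P.K) :
    (μH[1] : Measure Plane).restrict (P.edge k) ≤ (μH[1] : Measure Plane).restrict (frontier P.Ω) :=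
  Measure.restrict_mono (edge_subset_frontier k) le_rfl

lemma IsTrace.memLp_edge {u : Plane → ℝ} {G : Fin 2 → Plane → ℝ} {γ : Plane → ℝ}
    (h : IsTrace P.Ω u G γ) (k : Fin P.K) : MemLp γ 2 ((μH[1] : Measure Plane).restrict (P.edge k)) :=
  h.1.mono_measure (restrict_edge_le k)

/-- Integration by parts for a Sobolev function `u` with weak gradient `G` and trace `γ`. -/
lemma IsTrace.integral_mul {u : Plane → ℝ} {G : Fin 2 → Plane → ℝ} {γ : Plane → ℝ}
    (h : IsTrace P.Ω u G γ) (hu : MemL2 P.Ω u) (hG : ∀ i, MemL2 P.Ω (G i))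
    (hg : IsBoundedC1 P g g') (j : Fin 2) :
    ∫ x in P.Ω, G j x * g x = - (∫ x in P.Ω, u x * g' x (unitVec j)) +
      ∑ k, P.normal k j * ∫ x in P.edge k, γ x * g x ∂μH[1] := by
  have htr := h
  obtain ⟨-, φ, hφ, h1, h2, h3⟩ := h
  have hφ1 : ∀ n, IsBoundedC1 P (φ n) (fderiv ℝ (φ n)) := fun n => isBoundedC1_of_smooth (hφ n)
  -- For the smooth approximations this is the Gauss theorem for `φ n * g`. Every term passes to the
  -- limit because `g` and its derivative are bounded, hence square integrable.
  have hgauss : ∀ n, ∫ x in P.Ω, partialDeriv j (φ n) x * g x =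
      - (∫ x in P.Ω, φ n x * g' x (unitVec j)) +
      ∑ k, P.normal k j * ∫ x in P.edge k, φ n x * g x ∂μH[1] := by
    intro n
    have := gaussFormula ((hφ1 n).mul hg) (unitVec j)
    simp only [inner_unitVec, _root_.add_apply, _root_.smul_apply,
      smul_eq_mul] at this
    rw [integral_add] at this
    · rw [← this]
      have h0 : ∀ x, g x * fderiv ℝ (φ n) x (unitVec j) = partialDeriv j (φ n) x * g x :=
        fun x => mul_comm _ _
      simp only [h0]; ring
    · exact (hφ1 n).memLp_domain.integrable_mul (hg.memLp_deriv _)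
    · exact hg.memLp_domain.integrable_mul ((hφ1 n).memLp_deriv _)
  have hl : Tendsto (fun n => ∫ x in P.Ω, partialDeriv j (φ n) x * g x) atTop
      (𝓝 (∫ x in P.Ω, G j x * g x)) :=
    tendsto_integral_mul (hG j) (fun n => memL2_of_smooth (contDiff_partialDeriv (hφ n) j))
      hg.memLp_domain (h2 j)
  have hr1 : Tendsto (fun n => ∫ x in P.Ω, φ n x * g' x (unitVec j)) atTop
      (𝓝 (∫ x in P.Ω, u x * g' x (unitVec j))) :=
    tendsto_integral_mul hu (fun n => memL2_of_smooth (hφ n)) (hg.memLp_deriv _) h1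
  have hr2 : ∀ k, Tendsto (fun n => ∫ x in P.edge k, φ n x * g x ∂μH[1]) atTop
      (𝓝 (∫ x in P.edge k, γ x * g x ∂μH[1])) := by
    intro k
    refine tendsto_integral_mul (htr.memLp_edge k) (fun n => (hφ1 n).memLp_edge k 2)
      (hg.memLp_edge k 2) ?_
    exact tendsto_of_tendsto_of_tendsto_of_le_of_le tendsto_const_nhds h3 (fun _ => zero_le)
      fun n => eLpNorm_mono_measure _ (restrict_edge_le k)
  have hr := hr1.neg.add (tendsto_finsetSum Finset.univ
    fun k _ => (hr2 k).const_mul (P.normal k j))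
  exact tendsto_nhds_unique hl (hr.congr fun n => (hgauss n).symm)

/-- The weak Hessian is symmetric. -/
lemma IsH2.hess_symm {v : Plane → ℝ} {G : Fin 2 → Plane → ℝ} {H : Fin 2 → Fin 2 → Plane → ℝ}
    (h : IsH2 P.Ω v G H) : ∀ᵐ x ∂volume.restrict P.Ω, H 0 1 x = H 1 0 x := by
  have hint : ∀ i j, IntegrableOn (H i j) P.Ω := fun i j =>
    (h.memL2_hess i j).integrable one_le_two
  -- Both weak derivatives move onto the test function, where their order is irrelevant.
  have key : ∀ φ : Plane → ℝ, ContDiff ℝ ∞ φ → HasCompactSupport φ → tsupport φ ⊆ P.Ω →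
      ∀ i j, ∫ x in P.Ω, H i j x * φ x = ∫ x in P.Ω, v x * partialDeriv i (partialDeriv j φ) x := by
    intro φ hφ hc hs i j
    have h1 := h.hess i j φ hφ hc hs
    have h2 := h.grad i (partialDeriv j φ) (contDiff_partialDeriv hφ j)
      (hc.mono' (subset_closure.trans (tsupport_partialDeriv_subset φ j)))
      ((tsupport_partialDeriv_subset φ j).trans hs)
    linarith
  have := P.isOpen.ae_eq_zero_of_integral_contDiff_smul_eq_zero (μ := volume)
    (f := fun x => H 0 1 x - H 1 0 x) ((hint 0 1).sub (hint 1 0)).locallyIntegrableOn (by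
      intro φ hφ hc hs
      have hz : ∀ x, x ∉ P.Ω → φ x • (H 0 1 x - H 1 0 x) = 0 := by
        intro x hx
        rw [image_eq_zero_of_notMem_tsupport fun hx' => hx (hs hx'), zero_smul]
      rw [← setIntegral_eq_integral_of_forall_compl_eq_zero hz]
      have hφb : MemL2 P.Ω φ := memL2_of_smooth hφ
      have e : ∀ x, φ x • (H 0 1 x - H 1 0 x) = H 0 1 x * φ x - H 1 0 x * φ x := by
        intro x; rw [smul_eq_mul]; ring
      simp only [e]
      have hi : ∀ i j, IntegrableOn (fun x => H i j x * φ x) P.Ω := fun i j =>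
        (h.memL2_hess i j).integrable_mul hφb
      rw [integral_sub (hi 0 1) (hi 1 0), key φ hφ hc hs, key φ hφ hc hs]
      simp only [partialDeriv_comm hφ 0 1, sub_self])
  rw [ae_restrict_iff' P.isOpen.measurableSet]
  filter_upwards [this] with x hx hxΩ
  exact sub_eq_zero.1 (hx hxΩ)

/-- The boundary integral of the tangential derivative, weighted with `g`. -/
lemma integral_tangential {v : Plane → ℝ} {G : Fin 2 → Plane → ℝ} {H : Fin 2 → Fin 2 → Plane → ℝ}
    (h : IsH2 P.Ω v G H) {γ : Fin 2 → Plane → ℝ} (hγ : ∀ i, IsTrace P.Ω (G i) (H i) (γ i))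
    (hg : IsBoundedC1 P g g') :
    ∑ k, ∫ x in P.edge k, (∑ i, γ i x * P.tangent k i) * g x ∂μH[1] =
      (∫ x in P.Ω, G 1 x * g' x (unitVec 0)) - ∫ x in P.Ω, G 0 x * g' x (unitVec 1) := by
  have h1 := (hγ 1).integral_mul (h.memL2_grad 1) (h.memL2_hess 1) hg 0
  have h0 := (hγ 0).integral_mul (h.memL2_grad 0) (h.memL2_hess 0) hg 1
  -- Subtracting the two identities cancels the mixed second derivatives. The boundary terms combine
  -- to the tangential derivative because the tangent is the normal turned by a right angle.
  have hsymm : ∫ x in P.Ω, H 0 1 x * g x = ∫ x in P.Ω, H 1 0 x * g x := by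
    refine integral_congr_ae ?_
    filter_upwards [h.hess_symm] with x hx
    rw [hx]
  have hsum : ∑ k, ∫ x in P.edge k, (∑ i, γ i x * P.tangent k i) * g x ∂μH[1] =
      (∑ k, P.normal k 0 * ∫ x in P.edge k, γ 1 x * g x ∂μH[1]) -
      ∑ k, P.normal k 1 * ∫ x in P.edge k, γ 0 x * g x ∂μH[1] := by
    rw [← Finset.sum_sub_distrib]
    refine Finset.sum_congr rfl fun k _ => ?_
    have hi : ∀ i, Integrable (fun x => γ i x * g x) ((μH[1] : Measure Plane).restrict (P.edge k)) :=
      fun i => ((hγ i).memLp_edge k).integrable_mul (hg.memLp_edge k 2)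
    rw [← integral_const_mul, ← integral_const_mul, ← integral_sub ((hi 1).const_mul _)
      ((hi 0).const_mul _)]
    refine integral_congr_ae (ae_of_all _ fun x => ?_)
    simp only [Fin.sum_univ_two, normal_zero, normal_one]
    ring
  rw [hsum]
  linarith

/-- If the trace of `v` vanishes on an edge, then so does its tangential derivative. -/
lemma tangential_eq_zero {v : Plane → ℝ} {G : Fin 2 → Plane → ℝ} {H : Fin 2 → Fin 2 → Plane → ℝ}
    (h : IsH2 P.Ω v G H) {γ : Fin 2 → Plane → ℝ} (hγ : ∀ i, IsTrace P.Ω (G i) (H i) (γ i))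
    {β : Plane → ℝ} (hβ : IsTrace P.Ω v G β) (k : Fin P.K)
    (h0 : ∀ᵐ x ∂(μH[1].restrict (P.edge k)), β x = 0) :
    ∀ᵐ x ∂(μH[1].restrict (P.edge k)), ∑ i, γ i x * P.tangent k i = 0 := by
  -- Test functions supported in `U` vanish on all edges but `k`, so the sums over the boundary
  -- reduce to this edge.
  set U : Set Plane := (⋃ l ∈ {l | l ≠ k}, segment ℝ (P.vertex l) (P.vertex (P.next l)))ᶜ
  have hU : IsOpen U := ((toFinite _).isClosed_biUnion fun l _ =>
    (isCompact_segment l).isClosed).isOpen_compl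
  have hkU : P.edge k ⊆ U := by
    intro x hx hx'
    simp only [mem_iUnion] at hx'
    obtain ⟨l, hl, hx'⟩ := hx'
    exact notMem_segment_of_mem_edge hl hx hx'
  have hlU : ∀ l ≠ k, ∀ x ∈ P.edge l, x ∉ U := fun l hl x hx hx' =>
    hx' (mem_biUnion hl (openSegment_subset_segment ℝ _ _ hx))
  have hint : Integrable (fun x => ∑ i, γ i x * P.tangent k i)
      ((μH[1] : Measure Plane).restrict (P.edge k)) :=
    integrable_finsetSum _ fun i _ => (((hγ i).memLp_edge k).integrable one_le_two).mul_const _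
  have := hU.ae_eq_zero_of_integral_contDiff_smul_eq_zero (μ := μH[1].restrict (P.edge k))
    (f := fun x => ∑ i, γ i x * P.tangent k i) hint.integrableOn.locallyIntegrableOn (by
      intro η hη _ hs
      have hz : ∀ l ≠ k, ∀ φ : Plane → ℝ, tsupport φ ⊆ U → ∀ x ∈ P.edge l, φ x = 0 :=
        fun l hl φ hφ x hx => image_eq_zero_of_notMem_tsupport fun hx' => hlU l hl x hx (hφ hx')
      have h1 := integral_tangential h hγ (isBoundedC1_of_smooth (P := P) hη)
      rw [Finset.sum_eq_single k (fun l _ hl => setIntegral_eq_zero_of_forall_eq_zero fun x hx => by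
        rw [hz l hl η hs x hx, mul_zero]) (by simp)] at h1
      -- A further integration by parts has no boundary term: the trace of `v` vanishes on edge `k`,
      -- and `η` on the others. What remains are mixed second derivatives of `η`, which cancel in
      -- `h1`.
      have h2 : ∀ i j, ∫ x in P.Ω, G i x * fderiv ℝ η x (unitVec j) =
          - ∫ x in P.Ω, v x * partialDeriv i (partialDeriv j η) x := by
        intro i j
        have h3 := hβ.integral_mul h.memL2 h.memL2_grad
          (isBoundedC1_of_smooth (P := P) (contDiff_partialDeriv hη j)) i
        rw [Finset.sum_eq_zero, add_zero] at h3
        · exact h3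
        · intro l _
          by_cases hl : l = k
          · subst hl
            rw [integral_eq_zero_of_ae, mul_zero]
            filter_upwards [h0] with x hx
            rw [hx, zero_mul]; rfl
          · rw [setIntegral_eq_zero_of_forall_eq_zero, mul_zero]
            intro x hx
            rw [hz l hl _ ((tsupport_partialDeriv_subset η j).trans hs) x hx, mul_zero]
      rw [h2, h2] at h1
      simp only [partialDeriv_comm hη 0 1, sub_self] at h1
      simp only [smul_eq_mul, mul_comm (η _)]
      exact h1)
  filter_upwards [this, ae_restrict_mem (measurableSet_edge k)] with x hx hxk
  exact hx (hkU hxk)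

/-- The Cauchy-Schwarz inequality, with the norm of `b` as the constant. -/
lemma exists_bound_integral_mul {b : Plane → ℝ} (hb : MemL2 P.Ω b) :
    ∃ C, 0 ≤ C ∧ ∀ u, MemL2 P.Ω u → |∫ x in P.Ω, u x * b x| ≤ C * √(∫ x in P.Ω, u x ^ 2) :=
  ⟨√(∫ x in P.Ω, b x ^ 2), Real.sqrt_nonneg _, fun u hu => by
    rw [mul_comm]; exact abs_integral_mul_le hu hb⟩

lemma sqrt_integral_grad_le (v : Plane → ℝ) (G : Fin 2 → Plane → ℝ) (i : Fin 2) :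
    √(∫ x in P.Ω, G i x ^ 2) ≤ normH1 P.Ω v G := by
  refine Real.sqrt_le_sqrt ?_
  have h0 : 0 ≤ ∫ x in P.Ω, v x ^ 2 := integral_nonneg fun x => sq_nonneg _
  have := Finset.single_le_sum (f := fun i => ∫ x in P.Ω, G i x ^ 2)
    (fun i _ => integral_nonneg fun x => sq_nonneg _) (Finset.mem_univ i)
  linarith

end

/-! ### Extending edge functions into the domain -/

section

open PolygonalDomain

/-- The component along `a` of the unit vector in the direction of `y`. -/
def angular (a y : Plane) : ℝ := inner ℝ a (‖y‖⁻¹ • y)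

lemma abs_angular_le (a y : Plane) : |angular a y| ≤ ‖a‖ := by
  refine (abs_real_inner_le_norm _ _).trans (mul_le_of_le_one_right (norm_nonneg _) ?_)
  rw [norm_smul, norm_inv, norm_norm]
  exact inv_mul_le_one

lemma angular_smul (a : Plane) {e : Plane} (he : ‖e‖ = 1) {c : ℝ} (hc : 0 < c) :
    angular a (c • e) = inner ℝ a e := by
  rw [angular, norm_smul, he, mul_one, Real.norm_of_nonneg hc.le, inv_smul_smul₀ hc.ne']

lemma contDiffOn_angular (a : Plane) : ContDiffOn ℝ 1 (angular a) {0}ᶜ := by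
  intro y hy
  have hy' : y ≠ 0 := hy
  have h1 : ContDiffAt ℝ 1 (fun y : Plane => ‖y‖⁻¹) y :=
    (contDiffAt_norm ℝ hy').inv (norm_ne_zero_iff.2 hy')
  exact (contDiffAt_const.inner ℝ (h1.smul contDiffAt_id)).contDiffWithinAt

/-- The difference of the unit vectors is `(1/‖x‖ - 1/‖y‖) x + (x - y)/‖y‖`, and both terms are at
most `‖x - y‖ / ‖y‖`. For `x = 0` the first term is zero, so only `y` has to be nonzero. -/
lemma abs_angular_sub_le (a x : Plane) {y : Plane} (hy : y ≠ 0) :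
    |angular a x - angular a y| ≤ 2 * ‖a‖ * ‖y‖⁻¹ * ‖x - y‖ := by
  have hy0 : 0 < ‖y‖ := norm_pos_iff.2 hy
  rw [angular, angular, ← inner_sub_right]
  refine (abs_real_inner_le_norm _ _).trans ?_
  have h1 : ‖x‖⁻¹ • x - ‖y‖⁻¹ • y = (‖x‖⁻¹ - ‖y‖⁻¹) • x + ‖y‖⁻¹ • (x - y) := by
    rw [sub_smul, smul_sub]; abel
  have h2 : ‖(‖x‖⁻¹ - ‖y‖⁻¹) • x‖ ≤ ‖y‖⁻¹ * ‖x - y‖ := by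
    rcases eq_or_ne x 0 with rfl | hx
    · simp only [smul_zero, norm_zero]; positivity
    have hx0 : 0 < ‖x‖ := norm_pos_iff.2 hx
    have h3 : ‖x‖⁻¹ - ‖y‖⁻¹ = (‖y‖ - ‖x‖) * ‖y‖⁻¹ * ‖x‖⁻¹ := by field_simp
    rw [norm_smul, h3, norm_mul, norm_mul, norm_inv, norm_inv, norm_norm, norm_norm,
      inv_mul_cancel_right₀ hx0.ne', mul_comm, norm_sub_rev]
    gcongr
    exact abs_norm_sub_norm_le x y
  have h4 : ‖‖y‖⁻¹ • (x - y)‖ = ‖y‖⁻¹ * ‖x - y‖ := by rw [norm_smul, norm_inv, norm_norm]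
  calc ‖a‖ * ‖‖x‖⁻¹ • x - ‖y‖⁻¹ • y‖ ≤ ‖a‖ * (‖y‖⁻¹ * ‖x - y‖ + ‖y‖⁻¹ * ‖x - y‖) := by
        rw [h1]
        gcongr
        exact (norm_add_le _ _).trans (add_le_add h2 h4.le)
    _ = _ := by ring

lemma hasFDerivAt_angular (a : Plane) {y : Plane} (hy : y ≠ 0) :
    HasFDerivAt (angular a) (fderiv ℝ (angular a) y) y :=
  (((contDiffOn_angular a).contDiffAt (isOpen_compl_singleton.mem_nhds hy)).differentiableAt
    one_ne_zero).hasFDerivAt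

/-- A Lipschitz estimate with base point `y` bounds the derivative at `y`. The growth like `1 / ‖y‖`
is what a factor vanishing at the corner has to absorb. -/
lemma norm_fderiv_angular_le (a : Plane) {y : Plane} (hy : y ≠ 0) :
    ‖fderiv ℝ (angular a) y‖ ≤ 2 * ‖a‖ * ‖y‖⁻¹ :=
  (hasFDerivAt_angular a hy).le_of_lip' (by positivity)
    (Eventually.of_forall fun x => abs_angular_sub_le a x hy)

lemma cross_homothety (a p d x : Plane) (s : ℝ) (h : cross d (p - a) = 0) :
    cross d (p + s • (x - p) - a) = s * cross d (x - a) := by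
  simp only [cross, PiLp.sub_apply, PiLp.add_apply, PiLp.smul_apply, smul_eq_mul] at h ⊢
  linear_combination (1 - s) * h

variable {P : PolygonalDomain} {g : Plane → ℝ} {g' : Plane → Plane →L[ℝ] ℝ}

/-- Near a corner the domain is star shaped with respect to the corner. -/
lemma exists_starShaped_corner (k : Fin P.K) : ∃ r > 0, ∀ x ∈ P.Ω,
    ‖x - P.vertex (P.next k)‖ < r → ∀ s ∈ Ioc (0 : ℝ) 1,
      P.vertex (P.next k) + s • (x - P.vertex (P.next k)) ∈ P.Ω := by
  set p := P.vertex (P.next k)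
  have hball : ∀ r, ∀ x, ‖x - p‖ < r → ∀ s ∈ Ioc (0 : ℝ) 1,
      p + s • (x - p) ∈ Metric.ball p r := by
    intro r x hx s hs
    rw [mem_ball_iff_norm, add_sub_cancel_left, norm_smul, Real.norm_of_nonneg hs.1.le]
    exact (mul_le_of_le_one_left (norm_nonneg _) hs.2).trans_lt hx
  -- Homotheties centered at the corner preserve the sides of both lines through it, hence also the
  -- intersection or union of the two half planes.
  have h1 : ∀ x, ∀ s ∈ Ioc (0 : ℝ) 1,
      (LeftOf (P.vertex k) p (p + s • (x - p)) ↔ LeftOf (P.vertex k) p x) := by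
    intro x s hs
    rw [LeftOf, cross_homothety _ _ _ _ _ (by simp [cross, mul_comm]), LeftOf,
      mul_pos_iff_of_pos_left hs.1]
  have h2 : ∀ x, ∀ s ∈ Ioc (0 : ℝ) 1,
      (LeftOf p (P.vertex (P.next (P.next k))) (p + s • (x - p)) ↔
        LeftOf p (P.vertex (P.next (P.next k))) x) := by
    intro x s hs
    rw [LeftOf, cross_homothety _ _ _ _ _ (by simp [cross]), LeftOf,
      mul_pos_iff_of_pos_left hs.1]
  rcases le_or_gt 0 (cross (P.vertex (P.next k) - P.vertex k)
    (P.vertex (P.next (P.next k)) - P.vertex (P.next k))) with hc | hc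
  · obtain ⟨r, hr, H⟩ := P.corner_convex k hc
    refine ⟨r, hr, fun x hx hxr s hs => ?_⟩
    rw [H _ (hball r x hxr s hs), h1 x s hs, h2 x s hs, ← H x (mem_ball_iff_norm.2 hxr)]
    exact hx
  · obtain ⟨r, hr, H⟩ := P.corner_reentrant k hc
    refine ⟨r, hr, fun x hx hxr s hs => ?_⟩
    rw [H _ (hball r x hxr s hs), h1 x s hs, h2 x s hs, ← H x (mem_ball_iff_norm.2 hxr)]
    exact hx

/-- Close to the corner this is the mean value theorem on the segment to the corner, which stays in
the domain by `exists_starShaped_corner`. At distance at least `r` the bound of `g` suffices, which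
gives the constant `M / r`. -/
lemma abs_le_mul_norm_sub_corner (hg : IsBoundedC1 P g g') (hc : ContinuousOn g (closure P.Ω))
    (k : Fin P.K) (h0 : g (P.vertex (P.next k)) = 0) :
    ∃ C, 0 ≤ C ∧ ∀ x ∈ P.Ω, |g x| ≤ C * ‖x - P.vertex (P.next k)‖ := by
  obtain ⟨r, hr, hstar⟩ := exists_starShaped_corner k
  obtain ⟨M, hM⟩ := hg.bdd
  obtain ⟨M', hM'⟩ := hg.bdd'
  set p := P.vertex (P.next k)
  have hp : p ∈ closure P.Ω := frontier_subset_closure (vertex_mem_frontier _)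
  refine ⟨max (max M' (M / r)) 0, le_max_right _ _, fun x hx => ?_⟩
  rcases lt_or_ge ‖x - p‖ r with hxr | hxr
  · have hline : Continuous fun s : ℝ => p + s • (x - p) := by fun_prop
    obtain ⟨s, hs, hslope⟩ := exists_hasDerivAt_eq_slope (fun s : ℝ => g (p + s • (x - p)))
      (fun s => g' (p + s • (x - p)) (x - p)) zero_lt_one
      (hc.comp hline.continuousOn (fun s hs => by
        rcases hs.1.eq_or_lt with rfl | h
        · simpa using hp
        · exact subset_closure (hstar x hx hxr s ⟨h, hs.2⟩)))
      (fun s hs => by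
        have h1 := hg.deriv _ (hstar x hx hxr s ⟨hs.1, hs.2.le⟩)
        have h2 : HasDerivAt (fun s : ℝ => p + s • (x - p)) (x - p) s := by
          simpa using ((hasDerivAt_id s).smul_const (x - p)).const_add p
        exact h1.comp_hasDerivAt s h2)
    simp only [one_smul, zero_smul, add_zero, sub_zero, div_one, h0, add_sub_cancel] at hslope
    rw [← hslope, ← Real.norm_eq_abs]
    refine (ContinuousLinearMap.le_opNorm _ _).trans ?_
    gcongr
    exact (hM' _ (hstar x hx hxr s ⟨hs.1, hs.2.le⟩)).trans
      ((le_max_left _ _).trans (le_max_left _ _))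
  · have h1 := hM x (subset_closure_diff hx)
    calc |g x| ≤ M / r * r := by rwa [div_mul_cancel₀ _ hr.ne']
      _ ≤ max (max M' (M / r)) 0 * ‖x - p‖ := by
        gcongr
        exact (le_max_right _ _).trans (le_max_left _ _)

/-- The product of a function vanishing at a corner with a function of the polar angle there. -/
lemma IsBoundedC1.mul_angular (hg : IsBoundedC1 P g g') (hc : ContinuousOn g (closure P.Ω))
    (k : Fin P.K) (h0 : g (P.vertex (P.next k)) = 0) (a : Plane) (c : ℝ) :
    ∃ ψ', IsBoundedC1 P (fun x => g x * (angular a (x - P.vertex (P.next k)) - c)) ψ' := by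
  obtain ⟨C, hC0, hC⟩ := abs_le_mul_norm_sub_corner hg hc k h0
  obtain ⟨M, hM⟩ := hg.bdd
  obtain ⟨M', hM'⟩ := hg.bdd'
  set p := P.vertex (P.next k)
  have hne : ∀ x ∈ closure P.Ω \ range P.vertex, x - p ≠ 0 := fun x hx h =>
    hx.2 ⟨_, (sub_eq_zero.1 h).symm⟩
  have hb : ∀ y, |angular a y - c| ≤ ‖a‖ + |c| := fun y =>
    (abs_sub _ _).trans (add_le_add_left (abs_angular_le a y) _)
  have hsub : Continuous fun x : Plane => x - p := by fun_prop
  have hθc : ContinuousOn (fun x => angular a (x - p) - c) (closure P.Ω \ range P.vertex) :=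
    ((contDiffOn_angular a).continuousOn.comp hsub.continuousOn hne).sub continuousOn_const
  refine ⟨fun x => g x • fderiv ℝ (angular a) (x - p) + (angular a (x - p) - c) • g' x,
    hg.cont.mul hθc, ⟨M * (‖a‖ + |c|), fun x hx => ?_⟩, fun x hx => ?_, ?_,
    ⟨C * (2 * ‖a‖) + (‖a‖ + |c|) * M', fun x hx => ?_⟩⟩
  · rw [abs_mul]
    exact mul_le_mul (hM x hx) (hb _) (abs_nonneg _) ((abs_nonneg _).trans (hM x hx))
  · refine (hg.deriv x hx).mul (HasFDerivAt.sub_const c ?_)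
    have := (hasFDerivAt_angular a (hne x (subset_closure_diff hx))).comp x
      ((hasFDerivAt_id x).sub_const p)
    exact this
  · refine (hg.cont_domain.smul ?_).add ((hθc.mono subset_closure_diff).smul hg.cont')
    exact ((contDiffOn_angular a).continuousOn_fderiv_of_isOpen isOpen_compl_singleton
      le_rfl).comp hsub.continuousOn fun x hx => hne x (subset_closure_diff hx)
  · have hx0 := hne x (subset_closure_diff hx)
    have hpos : 0 < ‖x - p‖ := norm_pos_iff.2 hx0
    refine (norm_add_le _ _).trans (add_le_add ?_ ?_)
    · rw [norm_smul]
      -- The zero of `g` at the corner compensates the singular gradient of the angular function.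
      calc ‖g x‖ * ‖fderiv ℝ (angular a) (x - p)‖
          ≤ (C * ‖x - p‖) * (2 * ‖a‖ * ‖x - p‖⁻¹) :=
            mul_le_mul (hC x hx) (norm_fderiv_angular_le a hx0) (norm_nonneg _) (by positivity)
        _ = _ := by field_simp
    · rw [norm_smul]
      exact mul_le_mul (hb _) (hM' x hx) (norm_nonneg _) (by positivity)

lemma tangent_next_ne (k : Fin P.K) : P.tangent (P.next k) ≠ - P.tangent k := by
  intro h
  refine P.corner_ne k ?_
  have h1 : P.vertex k - P.vertex (P.next k) = P.length k • (-P.tangent k) := by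
    rw [← param_length k, param]; simp
  have h2 : P.vertex (P.next (P.next k)) - P.vertex (P.next k) =
      P.length (P.next k) • (-P.tangent k) := by
    rw [← param_length (P.next k), param, h]; simp
  rw [h1, h2]
  exact (SameRay.refl _).pos_smul_left (length_pos k) |>.pos_smul_right (length_pos _)

/-- Functions on two adjacent edges that agree at their common corner are the boundary values of
one function. -/
lemma exists_extension_corner {f₁ f₂ : Plane → ℝ} {f₁' f₂' : Plane → Plane →L[ℝ] ℝ}
    (h₁ : IsBoundedC1 P f₁ f₁') (h₂ : IsBoundedC1 P f₂ f₂') (c₁ : ContinuousOn f₁ (closure P.Ω))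
    (c₂ : ContinuousOn f₂ (closure P.Ω)) (k : Fin P.K)
    (heq : f₁ (P.vertex (P.next k)) = f₂ (P.vertex (P.next k))) :
    ∃ ψ ψ', IsBoundedC1 P ψ ψ' ∧ (∀ x ∈ P.edge k, ψ x = f₁ x) ∧
      ∀ x ∈ P.edge (P.next k), ψ x = f₂ x := by
  set e₁ := -P.tangent k with he₁
  set e₂ := P.tangent (P.next k) with he₂
  have hne : e₂ - e₁ ≠ 0 := sub_ne_zero.2 (tangent_next_ne k)
  -- The vectors `e₁`, `e₂` point from the corner into the two edges. The scaling makes `angular a -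
  -- inner ℝ a e₁` zero on the first edge and one on the second, so it interpolates from `f₁` to
  -- `f₂`.
  set a : Plane := (‖e₂ - e₁‖ ^ 2)⁻¹ • (e₂ - e₁)
  obtain ⟨ψ', hψ⟩ := (h₂.add ((IsBoundedC1.const (-1)).mul h₁)).mul_angular
    (c₂.add (continuousOn_const.mul c₁)) k (by rw [heq]; ring) a (inner ℝ a e₁)
  refine ⟨_, _, h₁.add hψ, fun x hx => ?_, fun x hx => ?_⟩
  · rw [edge_eq_image] at hx
    obtain ⟨s, hs, rfl⟩ := hx
    have : P.param k s - P.vertex (P.next k) = (P.length k - s) • e₁ := by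
      rw [← param_length k, param, param, he₁]; module
    rw [this, angular_smul a (by rw [he₁, norm_neg, norm_tangent]) (sub_pos.2 hs.2)]
    ring
  · rw [edge_eq_image] at hx
    obtain ⟨s, hs, rfl⟩ := hx
    have : P.param (P.next k) s - P.vertex (P.next k) = s • e₂ := by
      rw [param, he₂]; module
    have h1 : inner ℝ a e₂ - inner ℝ a e₁ = 1 := by
      rw [← inner_sub_right, inner_smul_left, real_inner_self_eq_norm_sq]
      simp [norm_ne_zero_iff.2 hne]
    rw [this, angular_smul a (norm_tangent _) hs.1, h1]
    ring

/-- Edge functions that agree at the common corners are the boundary values of one function. -/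
lemma exists_extension {f : Fin P.K → Plane → ℝ} {f' : Fin P.K → Plane → Plane →L[ℝ] ℝ}
    (hf : ∀ k, IsBoundedC1 P (f k) (f' k)) (hc : ∀ k, ContinuousOn (f k) (closure P.Ω))
    (S : Set (Fin P.K)) (hS : ∀ k ∈ S, P.next k ∈ S →
      f k (P.vertex (P.next k)) = f (P.next k) (P.vertex (P.next k))) :
    ∃ ψ ψ', IsBoundedC1 P ψ ψ' ∧ ∀ k ∈ S, ∀ x ∈ P.edge k, ψ x = f k x := by
  have hloc : ∀ k, ∃ ψ ψ', IsBoundedC1 P ψ ψ' ∧ (k ∈ S → ∀ x ∈ P.edge k, ψ x = f k x) ∧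
      (P.next k ∈ S → ∀ x ∈ P.edge (P.next k), ψ x = f (P.next k) x) := by
    intro k
    by_cases h1 : k ∈ S
    · by_cases h2 : P.next k ∈ S
      · obtain ⟨ψ, ψ', h, ha, hb⟩ := exists_extension_corner (hf k) (hf (P.next k)) (hc k)
          (hc (P.next k)) k (hS k h1 h2)
        exact ⟨ψ, ψ', h, fun _ => ha, fun _ => hb⟩
      · exact ⟨f k, f' k, hf k, fun _ _ _ => rfl, fun h => absurd h h2⟩
    · exact ⟨f (P.next k), f' (P.next k), hf _, fun h => absurd h h1, fun _ _ _ => rfl⟩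
  choose ψ ψ' hψ h1 h2 using hloc
  -- A piece supported in `U k` meets only the edges `k` and `P.next k`, where `ψ k` has the
  -- prescribed values if they are prescribed. Each corner lies in the set belonging to its incoming
  -- edge.
  set U : Fin P.K → Set Plane := fun k =>
    (⋃ l ∈ {l | l ≠ k ∧ l ≠ P.next k}, segment ℝ (P.vertex l) (P.vertex (P.next l)))ᶜ with hUdef
  have hU : ∀ k, IsOpen (U k) := fun k => ((toFinite _).isClosed_biUnion fun l _ =>
    (isCompact_segment l).isClosed).isOpen_compl
  have hcov : frontier P.Ω ⊆ ⋃ k, U k := by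
    intro x hx
    rw [mem_iUnion]
    by_cases hv : x ∈ range P.vertex
    · obtain ⟨l, rfl⟩ := hv
      refine ⟨P.next.symm l, fun h => ?_⟩
      simp only [mem_iUnion] at h
      obtain ⟨m, ⟨hm1, hm2⟩, h⟩ := h
      have := vertex_notMem_segment hm1 hm2
      rw [Equiv.apply_symm_apply] at this
      exact this h
    · obtain ⟨k, hk⟩ := mem_iUnion.1 (frontier_diff_vertices ⟨hx, hv⟩)
      refine ⟨k, fun h => ?_⟩
      simp only [mem_iUnion] at h
      obtain ⟨m, ⟨hm1, -⟩, h⟩ := h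
      exact notMem_segment_of_mem_edge hm1 hk h
  obtain ⟨χ, hχ, hχs, hχ1⟩ := exists_smooth_partition isClosed_frontier U hU hcov
  refine ⟨_, _, IsBoundedC1.sum Finset.univ fun k _ => (isBoundedC1_of_smooth (hχ k)).mul (hψ k),
    fun l hl x hx => ?_⟩
  have : ∀ k, χ k x * ψ k x = χ k x * f l x := by
    intro k
    by_cases hx0 : χ k x = 0
    · rw [hx0, zero_mul, zero_mul]
    · have hxU : x ∈ U k := hχs k (subset_tsupport _ hx0)
      by_cases hlk : l = k
      · subst hlk; rw [h1 l hl x hx]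
      · by_cases hlk' : l = P.next k
        · subst hlk'; rw [h2 k hl x hx]
        · have hseg := openSegment_subset_segment ℝ (P.vertex l) (P.vertex (P.next l)) hx
          have hl' : l ∈ {l | l ≠ k ∧ l ≠ P.next k} := ⟨hlk, hlk'⟩
          exact (hxU (mem_biUnion hl' hseg)).elim
  simp only [this, ← Finset.sum_mul]
  rw [hχ1 x (edge_subset_frontier l hx), one_mul]

end

/-! ### Sufficiency of the boundary conditions -/

section

open PolygonalDomain

variable {P : PolygonalDomain} {N : Plane → Matrix (Fin 2) (Fin 2) ℝ}

lemma continuousOn_component (hN : ∀ i j, IsC1UpToBoundary P.Ω (fun x => N x i j))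
    (a b : Plane) : ContinuousOn (fun x => component (N x) a b) (closure P.Ω) :=
  continuousOn_finsetSum _ fun i _ => (continuousOn_finsetSum _ fun j _ =>
    (hN i j).1.mul continuousOn_const).mul continuousOn_const

lemma exists_isBoundedC1_component (hN : ∀ i j, IsC1UpToBoundary P.Ω (fun x => N x i j))
    (a b : Plane) : ∃ f', IsBoundedC1 P (fun x => component (N x) a b) f' := by
  choose N' hN' using fun i j => IsBoundedC1.of_isC1UpToBoundary (hN i j)
  exact ⟨_, IsBoundedC1.sum Finset.univ fun i _ => (IsBoundedC1.sum Finset.univ fun j _ =>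
    (hN' i j).mul (IsBoundedC1.const (a j))).mul (IsBoundedC1.const (b i))⟩

lemma tangent_sq_add_sq (k : Fin P.K) : P.tangent k 0 ^ 2 + P.tangent k 1 ^ 2 = 1 := by
  have := EuclideanSpace.real_norm_sq_eq (P.tangent k)
  rw [norm_tangent, Fin.sum_univ_two] at this
  linarith

/-- Splitting of `G · (N n)` into normal and tangential parts. -/
lemma sum_mul_apply_normal (A : Matrix (Fin 2) (Fin 2) ℝ) (k : Fin P.K) (G : Fin 2 → ℝ) :
    ∑ i, ∑ j, P.normal k j * (G i * A i j) =
      component A (P.normal k) (P.normal k) * ∑ i, G i * P.normal k i +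
      component A (P.normal k) (P.tangent k) * ∑ i, G i * P.tangent k i := by
  simp only [component, Fin.sum_univ_two, normal_zero, normal_one]
  have h := tangent_sq_add_sq k
  linear_combination (-(G 0 * (A 0 0 * P.tangent k 1 - A 0 1 * P.tangent k 0)) -
    G 1 * (A 1 0 * P.tangent k 1 - A 1 1 * P.tangent k 0)) * h

/-- Integration by parts in `∫ ∇²v : N`. -/
lemma integral_hess_mul {v : Plane → ℝ} {G : Fin 2 → Plane → ℝ} {H : Fin 2 → Fin 2 → Plane → ℝ}
    (h : IsH2 P.Ω v G H) {γ : Fin 2 → Plane → ℝ} (hγ : ∀ i, IsTrace P.Ω (G i) (H i) (γ i))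
    {N' : Fin 2 → Fin 2 → Plane → Plane →L[ℝ] ℝ}
    (hN : ∀ i j, IsBoundedC1 P (fun x => N x i j) (N' i j)) :
    ∫ x in P.Ω, ∑ i, ∑ j, H i j x * N x i j =
      - (∑ i, ∑ j, ∫ x in P.Ω, G i x * N' i j x (unitVec j)) +
      ∑ k, ∫ x in P.edge k, (normalNormal P N k x * ∑ i, γ i x * P.normal k i +
        normalTangential P N k x * ∑ i, γ i x * P.tangent k i) ∂μH[1] := by
  have hi : ∀ i j, IntegrableOn (fun x => H i j x * N x i j) P.Ω := fun i j =>
    (h.memL2_hess i j).integrable_mul (hN i j).memLp_domain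
  have hb : ∀ k i j, Integrable (fun x => P.normal k j * (γ i x * N x i j))
      ((μH[1] : Measure Plane).restrict (P.edge k)) := fun k i j =>
    (((hγ i).memLp_edge k).integrable_mul ((hN i j).memLp_edge k 2)).const_mul _
  rw [integral_finsetSum _ fun i _ => integrable_finsetSum _ fun j _ => hi i j]
  have h1 : ∀ i, ∫ x in P.Ω, ∑ j, H i j x * N x i j = ∑ j, (- (∫ x in P.Ω, G i x *
      N' i j x (unitVec j)) + ∑ k, ∫ x in P.edge k, P.normal k j * (γ i x * N x i j) ∂μH[1]) := by
    intro i
    rw [integral_finsetSum _ fun j _ => hi i j]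
    refine Finset.sum_congr rfl fun j _ => ?_
    simp only [integral_const_mul]
    exact (hγ i).integral_mul (h.memL2_grad i) (h.memL2_hess i) (hN i j) j
  simp only [h1, Finset.sum_add_distrib, Finset.sum_neg_distrib]
  congr 1
  have h2 : ∀ k, ∫ x in P.edge k, (normalNormal P N k x * ∑ i, γ i x * P.normal k i +
        normalTangential P N k x * ∑ i, γ i x * P.tangent k i) ∂μH[1] =
      ∑ i, ∑ j, ∫ x in P.edge k, P.normal k j * (γ i x * N x i j) ∂μH[1] := by
    intro k
    simp only [normalNormal, normalTangential, ← sum_mul_apply_normal]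
    rw [integral_finsetSum _ fun i _ => integrable_finsetSum _ fun j _ => hb k i j]
    exact Finset.sum_congr rfl fun i _ => integral_finsetSum _ fun j _ => hb k i j
  simp only [h2]
  conv_rhs => rw [Finset.sum_comm]
  refine Finset.sum_congr rfl fun i _ => ?_
  rw [Finset.sum_comm]

/-- The boundary conditions are sufficient. -/
theorem memHDivDiv_of_boundary_conditions (bc : Fin P.K → BoundaryType) (hN : MemL2Sym P.Ω N)
    (hN1 : ∀ i j, IsC1UpToBoundary P.Ω (fun x => N x i j))
    (hnn : ∀ k, bc k = .simplySupported ∨ bc k = .free →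
      ∀ x ∈ P.edge k, normalNormal P N k x = 0)
    (hjump : ∀ k, bc k = .free → bc (P.next k) = .free → cornerJump P N k = 0) :
    MemHDivDiv P bc N := by
  refine ⟨hN, ?_⟩
  choose N' hN' using fun i j => IsBoundedC1.of_isC1UpToBoundary (hN1 i j)
  choose f' hf' using fun k => exists_isBoundedC1_component hN1 (P.normal k) (P.tangent k)
  -- Only the free edges prescribe values of `ψ`; on the others it is multiplied by a vanishing
  -- tangential derivative.
  obtain ⟨ψ, ψ', hψ, hψe⟩ := exists_extension hf'
    (fun k => continuousOn_component hN1 _ _) {k | bc k = .free}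
    (fun k h1 h2 => sub_eq_zero.1 (hjump k h1 h2))
  choose C hC0 hC using fun i j => exists_bound_integral_mul ((hN' i j).memLp_deriv (unitVec j))
  choose D hD0 hD using fun j => exists_bound_integral_mul (hψ.memLp_deriv (unitVec j))
  -- The `C i j` bound the divergence term, `D 0` and `D 1` the two terms of `integral_tangential`.
  refine ⟨(∑ i, ∑ j, C i j) + D 0 + D 1, fun v G H hv => ?_⟩
  obtain ⟨h2, ⟨β, hβ, hβ0⟩, γ, hγ, hγ0⟩ := hv
  rw [integral_hess_mul h2 hγ hN']
  have hedge : ∀ k, ∫ x in P.edge k, (normalNormal P N k x * ∑ i, γ i x * P.normal k i +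
        normalTangential P N k x * ∑ i, γ i x * P.tangent k i) ∂μH[1] =
      ∫ x in P.edge k, (∑ i, γ i x * P.tangent k i) * ψ x ∂μH[1] := by
    intro k
    refine integral_congr_ae ?_
    have hsupp : bc k = .clamped ∨ bc k = .simplySupported →
        ∀ᵐ x ∂(μH[1].restrict (P.edge k)), ∑ i, γ i x * P.tangent k i = 0 := fun hk =>
      tangential_eq_zero h2 hγ hβ k (hβ0 k hk)
    have hmem := ae_restrict_mem (μ := (μH[1] : Measure Plane)) (measurableSet_edge k)
    cases hk : bc k with
    | clamped =>
      filter_upwards [hsupp (Or.inl hk), hγ0 k hk] with x hx1 hx2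
      rw [hx1, hx2]; ring
    | simplySupported =>
      filter_upwards [hsupp (Or.inr hk), hmem] with x hx1 hx2
      rw [hx1, hnn k (Or.inl hk) x hx2]; ring
    | free =>
      filter_upwards [hmem] with x hx
      rw [hnn k (Or.inr hk) x hx, hψe k hk x hx, normalTangential]; ring
  simp only [hedge]
  rw [integral_tangential h2 hγ hψ]
  have hn : ∀ i, √(∫ x in P.Ω, G i x ^ 2) ≤ normH1 P.Ω v G := sqrt_integral_grad_le v G
  have h3 : ∀ i j, |∫ x in P.Ω, G i x * N' i j x (unitVec j)| ≤ C i j * normH1 P.Ω v G :=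
    fun i j => (hC i j _ (h2.memL2_grad i)).trans (mul_le_mul_of_nonneg_left (hn i) (hC0 i j))
  have h4 : ∀ i j, |∫ x in P.Ω, G i x * ψ' x (unitVec j)| ≤ D j * normH1 P.Ω v G :=
    fun i j => (hD j _ (h2.memL2_grad i)).trans (mul_le_mul_of_nonneg_left (hn i) (hD0 j))
  have h5 : |∑ i, ∑ j, ∫ x in P.Ω, G i x * N' i j x (unitVec j)| ≤
      (∑ i, ∑ j, C i j) * normH1 P.Ω v G := by
    rw [Finset.sum_mul]
    refine (Finset.abs_sum_le_sum_abs _ _).trans (Finset.sum_le_sum fun i _ => ?_)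
    rw [Finset.sum_mul]
    exact (Finset.abs_sum_le_sum_abs _ _).trans (Finset.sum_le_sum fun j _ => h3 i j)
  have h6 := h4 1 0
  have h7 := h4 0 1
  rw [abs_le] at h5 h6 h7 ⊢
  constructor <;> linarith [h5.1, h5.2, h6.1, h6.2, h7.1, h7.2]

end

/-! ### Smooth test functions and the boundary form -/

section

open PolygonalDomain

variable {P : PolygonalDomain} {N : Plane → Matrix (Fin 2) (Fin 2) ℝ}

lemma hasWeakPartial_of_smooth {u : Plane → ℝ} (hu : ContDiff ℝ ∞ u) (i : Fin 2) :
    HasWeakPartial P.Ω i u (partialDeriv i u) := by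
  intro φ hφ _ hs
  have hu1 := isBoundedC1_of_smooth (P := P) hu
  have hφ1 := isBoundedC1_of_smooth (P := P) hφ
  have := gaussFormula (hu1.mul hφ1) (unitVec i)
  simp only [_root_.add_apply, _root_.smul_apply, smul_eq_mul] at this
  have hi1 : IntegrableOn (fun x => u x * fderiv ℝ φ x (unitVec i)) P.Ω :=
    hu1.memLp_domain.integrable_mul (hφ1.memLp_deriv _)
  have hi2 : IntegrableOn (fun x => φ x * fderiv ℝ u x (unitVec i)) P.Ω :=
    hφ1.memLp_domain.integrable_mul (hu1.memLp_deriv _)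
  rw [integral_add hi1 hi2, Finset.sum_eq_zero] at this
  · have h0 : ∀ x, φ x * fderiv ℝ u x (unitVec i) = partialDeriv i u x * φ x :=
      fun x => mul_comm _ _
    simp only [h0] at this
    exact eq_neg_of_add_eq_zero_left this
  · intro k _
    rw [setIntegral_eq_zero_of_forall_eq_zero, mul_zero]
    intro x hx
    rw [image_eq_zero_of_notMem_tsupport (f := φ), mul_zero]
    intro hx'
    have := edge_subset_frontier k hx
    rw [P.isOpen.frontier_eq] at this
    exact this.2 (hs hx')

lemma isH2_of_smooth {v : Plane → ℝ} (hv : ContDiff ℝ ∞ v) :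
    IsH2 P.Ω v (fun i => partialDeriv i v) (fun i j => partialDeriv j (partialDeriv i v)) where
  memL2 := memL2_of_smooth hv
  memL2_grad i := memL2_of_smooth (contDiff_partialDeriv hv i)
  memL2_hess i j := memL2_of_smooth (contDiff_partialDeriv (contDiff_partialDeriv hv i) j)
  grad i := hasWeakPartial_of_smooth hv i
  hess i j := hasWeakPartial_of_smooth (contDiff_partialDeriv hv i) j

lemma hausdorffMeasure_frontier_lt_top : (μH[1] : Measure Plane) (frontier P.Ω) < ⊤ := by
  rw [P.frontier_eq]
  refine (measure_iUnion_le _).trans_lt ?_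
  rw [tsum_fintype]
  refine ENNReal.sum_lt_top.2 fun k _ => ?_
  rw [hausdorffMeasure_segment]
  exact edist_lt_top _ _

lemma isTrace_of_smooth {u : Plane → ℝ} (hu : ContDiff ℝ ∞ u) :
    IsTrace P.Ω u (fun i => partialDeriv i u) u := by
  refine ⟨?_, fun _ => u, fun _ => hu, by simp, by simp, by simp⟩
  have hc : IsCompact (frontier P.Ω) := P.isBounded.isCompact_closure.of_isClosed_subset
    isClosed_frontier frontier_subset_closure
  obtain ⟨M, hM⟩ := hc.exists_bound_of_continuousOn hu.continuous.continuousOn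
  have : IsFiniteMeasure ((μH[1] : Measure Plane).restrict (frontier P.Ω)) :=
    ⟨by rw [Measure.restrict_apply_univ]; exact hausdorffMeasure_frontier_lt_top⟩
  refine MemLp.of_bound hu.continuous.aestronglyMeasurable M ?_
  rw [ae_restrict_iff' isClosed_frontier.measurableSet]
  exact ae_of_all _ hM

lemma memW_of_smooth {bc : Fin P.K → BoundaryType} {v : Plane → ℝ} (hv : ContDiff ℝ ∞ v)
    (h0 : ∀ k, bc k = .clamped ∨ bc k = .simplySupported → ∀ x ∈ P.edge k, v x = 0)
    (h1 : ∀ k, bc k = .clamped → ∀ x ∈ P.edge k, ∑ i, partialDeriv i v x * P.normal k i = 0) :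
    MemW P bc v (fun i => partialDeriv i v) (fun i j => partialDeriv j (partialDeriv i v)) := by
  refine ⟨isH2_of_smooth hv, ⟨v, isTrace_of_smooth hv, fun k hk => ?_⟩,
    fun i => partialDeriv i v, fun i => isTrace_of_smooth (contDiff_partialDeriv hv i),
    fun k hk => ?_⟩
  · rw [ae_restrict_iff' (measurableSet_edge k)]
    exact ae_of_all _ (h0 k hk)
  · rw [ae_restrict_iff' (measurableSet_edge k)]
    exact ae_of_all _ (h1 k hk)

/-- The boundary integral of `∇v · N n`. -/
def boundaryForm (P : PolygonalDomain) (N : Plane → Matrix (Fin 2) (Fin 2) ℝ) (v : Plane → ℝ) : ℝ :=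
  ∑ k, ∫ x in P.edge k, (normalNormal P N k x * ∑ i, partialDeriv i v x * P.normal k i +
        normalTangential P N k x * ∑ i, partialDeriv i v x * P.tangent k i) ∂μH[1]

/-- The functional and the boundary form differ by the divergence term, which the H¹ norm controls.
Both necessity proofs test this bound with smooth functions satisfying the boundary conditions
pointwise. -/
lemma exists_bound_boundaryForm {bc : Fin P.K → BoundaryType}
    (hN1 : ∀ i j, IsC1UpToBoundary P.Ω (fun x => N x i j)) (hN : MemHDivDiv P bc N) :
    ∃ C, 0 ≤ C ∧ ∀ v : Plane → ℝ, ContDiff ℝ ∞ v →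
      (∀ k, bc k = .clamped ∨ bc k = .simplySupported → ∀ x ∈ P.edge k, v x = 0) →
      (∀ k, bc k = .clamped → ∀ x ∈ P.edge k, ∑ i, partialDeriv i v x * P.normal k i = 0) →
      |boundaryForm P N v| ≤ C * normH1 P.Ω v (fun i => partialDeriv i v) := by
  obtain ⟨-, C, hC⟩ := hN
  choose N' hN' using fun i j => IsBoundedC1.of_isC1UpToBoundary (hN1 i j)
  choose D hD0 hD using fun i j => exists_bound_integral_mul ((hN' i j).memLp_deriv (unitVec j))
  have hD0' : 0 ≤ ∑ i, ∑ j, D i j :=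
    Finset.sum_nonneg fun i _ => Finset.sum_nonneg fun j _ => hD0 i j
  refine ⟨|C| + ∑ i, ∑ j, D i j, by positivity, fun v hv h0 h1 => ?_⟩
  have hW := memW_of_smooth hv h0 h1
  have hbound := hC _ _ _ hW
  have hparts := integral_hess_mul (N := N) hW.isH2
    (fun i => isTrace_of_smooth (contDiff_partialDeriv hv i)) hN'
  set n := normH1 P.Ω v (fun i => partialDeriv i v)
  have hn0 : 0 ≤ n := Real.sqrt_nonneg _
  have h3 : |∑ i, ∑ j, ∫ x in P.Ω, partialDeriv i v x * N' i j x (unitVec j)| ≤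
      (∑ i, ∑ j, D i j) * n := by
    rw [Finset.sum_mul]
    refine (Finset.abs_sum_le_sum_abs _ _).trans (Finset.sum_le_sum fun i _ => ?_)
    rw [Finset.sum_mul]
    refine (Finset.abs_sum_le_sum_abs _ _).trans (Finset.sum_le_sum fun j _ => ?_)
    exact (hD i j _ (hW.isH2.memL2_grad i)).trans (mul_le_mul_of_nonneg_left
      (sqrt_integral_grad_le v (fun i => partialDeriv i v) i) (hD0 i j))
  have h4 : C * n ≤ |C| * n := mul_le_mul_of_nonneg_right (le_abs_self C) hn0
  rw [hparts] at hbound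
  change |_ + boundaryForm P N v| ≤ _ at hbound
  rw [abs_le] at hbound h3 ⊢
  constructor <;> linarith [hbound.1, hbound.2, h3.1, h3.2]

lemma fderiv_eq_sum (v : Plane → ℝ) (x w : Plane) :
    fderiv ℝ v x w = ∑ i, partialDeriv i v x * w i := by
  have : w = ∑ i, w i • unitVec i := by
    ext j
    fin_cases j <;> simp [unitVec, Fin.sum_univ_two]
  conv_lhs => rw [this]
  simp [partialDeriv, mul_comm]

end

/-! ### Necessity of the condition on the normal-normal component -/

section

open PolygonalDomain

variable {P : PolygonalDomain} {N : Plane → Matrix (Fin 2) (Fin 2) ℝ}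

/-- A function with unit slope at the origin, of size `O(1 / n)`. -/
def flatten (n : ℕ) (d : ℝ) : ℝ := d / (1 + (n * d) ^ 2)

lemma contDiff_flatten (n : ℕ) : ContDiff ℝ ∞ (flatten n) :=
  contDiff_id.div (by fun_prop) fun d => by positivity

@[simp] lemma flatten_zero (n : ℕ) : flatten n 0 = 0 := by simp [flatten]

lemma hasDerivAt_flatten (n : ℕ) (d : ℝ) :
    HasDerivAt (flatten n) ((1 - (n * d) ^ 2) / (1 + (n * d) ^ 2) ^ 2) d := by
  have h1 : HasDerivAt (fun d : ℝ => 1 + ((n : ℝ) * d) ^ 2) (2 * (n * d) * n) d := by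
    have := (((hasDerivAt_id d).const_mul (n : ℝ)).pow 2).const_add 1
    simpa using this
  have h2 := (hasDerivAt_id d).div h1 (by positivity)
  convert! h2 using 1
  simp only [id]
  congr 1; ring

lemma abs_flatten_le {n : ℕ} (hn : 0 < n) (d : ℝ) : |flatten n d| ≤ (n : ℝ)⁻¹ := by
  have hn' : (0 : ℝ) < n := Nat.cast_pos.2 hn
  have hpos : 0 < 1 + ((n : ℝ) * d) ^ 2 := by positivity
  rw [flatten, abs_div, abs_of_pos hpos, div_le_iff₀ hpos, inv_mul_eq_div, le_div_iff₀ hn']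
  have h1 : (n : ℝ) * |d| = |n * d| := by rw [abs_mul, Nat.abs_cast]
  rw [mul_comm, h1, ← sq_abs ((n : ℝ) * d)]
  nlinarith [sq_nonneg (|(n : ℝ) * d| - 1), abs_nonneg ((n : ℝ) * d)]

/-- This bound serves twice: it is at most one, which gives a dominating constant, and it tends to
zero for `d ≠ 0`. -/
lemma abs_deriv_flatten_le (n : ℕ) (d : ℝ) :
    |(1 - (n * d) ^ 2) / (1 + (n * d) ^ 2) ^ 2| ≤ 1 / (1 + (n * d) ^ 2) := by
  have hpos : 0 < 1 + ((n : ℝ) * d) ^ 2 := by positivity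
  rw [abs_div, abs_of_pos (by positivity : 0 < (1 + ((n : ℝ) * d) ^ 2) ^ 2),
    div_le_div_iff₀ (by positivity) hpos, one_mul, sq (1 + ((n : ℝ) * d) ^ 2)]
  refine mul_le_mul_of_nonneg_right (abs_le.2 ⟨?_, ?_⟩) hpos.le <;> nlinarith [sq_nonneg ((n : ℝ) * d)]

lemma tendsto_deriv_flatten {d : ℝ} (hd : d ≠ 0) :
    Tendsto (fun n : ℕ => (1 - (n * d) ^ 2) / (1 + (n * d) ^ 2) ^ 2) atTop (𝓝 0) := by
  refine squeeze_zero_norm (fun n => abs_deriv_flatten_le n d) ?_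
  have h1 : Tendsto (fun n : ℕ => ((n : ℝ)) ^ 2 * d ^ 2) atTop atTop :=
    ((tendsto_pow_atTop two_ne_zero).comp tendsto_natCast_atTop_atTop).atTop_mul_const
      (by positivity)
  have h2 := tendsto_atTop_add_const_left atTop (1 : ℝ) h1
  refine (tendsto_inv_atTop_zero.comp h2).congr fun n => ?_
  simp only [Function.comp, one_div, mul_pow]

/-- Signed distance to the line through edge `k`, positive outside. -/
def lineDist (P : PolygonalDomain) (k : Fin P.K) (x : Plane) : ℝ :=
  inner ℝ (P.normal k) (x - P.vertex k)

lemma lineDist_eq_zero {k : Fin P.K} {x : Plane} (hx : x ∈ P.edge k) : lineDist P k x = 0 := by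
  rw [edge_eq_image] at hx
  obtain ⟨s, -, rfl⟩ := hx
  rw [lineDist, param, add_sub_cancel_left, inner_smul_right, real_inner_comm,
    inner_tangent_normal, mul_zero]

lemma hasFDerivAt_lineDist (k : Fin P.K) (x : Plane) :
    HasFDerivAt (lineDist P k) (innerSL ℝ (P.normal k)) x :=
  (innerSL ℝ (P.normal k)).hasFDerivAt.comp x ((hasFDerivAt_id x).sub_const _)

lemma contDiff_lineDist (k : Fin P.K) : ContDiff ℝ ∞ (lineDist P k) :=
  contDiff_const.inner ℝ (contDiff_id.sub contDiff_const)

lemma ae_lineDist_ne_zero (k : Fin P.K) : ∀ᵐ x : Plane, lineDist P k x ≠ 0 := by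
  set S : AffineSubspace ℝ Plane := AffineSubspace.mk' (P.vertex k)
    (innerSL ℝ (P.normal k)).toLinearMap.ker
  have hS : S ≠ ⊤ := by
    intro h
    have h1 : P.vertex k + P.normal k ∈ S := by rw [h]; exact AffineSubspace.mem_top ℝ _ _
    rw [AffineSubspace.mem_mk'] at h1
    simp only [vsub_eq_sub, add_sub_cancel_left, LinearMap.mem_ker,
      ContinuousLinearMap.coe_coe, innerSL_apply_apply, real_inner_self_eq_norm_sq,
      norm_normal] at h1
    norm_num at h1
  have h0 := Measure.addHaar_affineSubspace volume S hS
  rw [ae_iff]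
  convert h0 using 2
  ext x
  simp [S, AffineSubspace.mem_mk', lineDist, inner_sub_right]

/-- Test functions that vanish on the line through edge `k` and have normal derivative `χ` there. -/
def edgeTest (P : PolygonalDomain) (k : Fin P.K) (χ : Plane → ℝ) (n : ℕ) (x : Plane) : ℝ :=
  χ x * flatten n (lineDist P k x)

section edgeTest

variable {χ : Plane → ℝ}

lemma contDiff_edgeTest (k : Fin P.K) (hχ : ContDiff ℝ ∞ χ) (n : ℕ) :
    ContDiff ℝ ∞ (edgeTest P k χ n) :=
  hχ.mul ((contDiff_flatten n).comp (contDiff_lineDist k))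

lemma fderiv_edgeTest (k : Fin P.K) (hχ : ContDiff ℝ ∞ χ) (n : ℕ) (x w : Plane) :
    fderiv ℝ (edgeTest P k χ n) x w =
      χ x * ((1 - (n * lineDist P k x) ^ 2) / (1 + (n * lineDist P k x) ^ 2) ^ 2 *
        inner ℝ (P.normal k) w) + flatten n (lineDist P k x) * fderiv ℝ χ x w := by
  have h1 := (hasDerivAt_flatten n (lineDist P k x)).comp_hasFDerivAt x (hasFDerivAt_lineDist k x)
  have h2 := ((hχ.differentiable (by simp) x).hasFDerivAt.mul h1).fderiv
  rw [show (χ * (flatten n ∘ lineDist P k)) = edgeTest P k χ n from rfl] at h2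
  rw [h2]
  simp

lemma tsupport_edgeTest_subset (k : Fin P.K) (n : ℕ) :
    tsupport (edgeTest P k χ n) ⊆ tsupport χ :=
  closure_mono fun _ hx => left_ne_zero_of_mul hx

/-- Dominated convergence. The values are of order `1 / n`; the gradients are bounded uniformly and
tend to zero off the line, which is a null set. The H¹ norm does not see that the normal derivative
on the line stays equal to `χ`. -/
lemma tendsto_normH1_edgeTest (k : Fin P.K) (hχ : ContDiff ℝ ∞ χ) (hc : HasCompactSupport χ) :
    Tendsto (fun n => normH1 P.Ω (edgeTest P k χ n) fun i => partialDeriv i (edgeTest P k χ n))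
      atTop (𝓝 0) := by
  obtain ⟨A, hA⟩ := hc.exists_bound_of_continuous hχ.continuous
  obtain ⟨B, hB⟩ := (hc.fderiv (𝕜 := ℝ)).exists_bound_of_continuous
    (hχ.continuous_fderiv (by simp))
  have hA0 : 0 ≤ A := (norm_nonneg _).trans (hA 0)
  have hB0 : 0 ≤ B := (norm_nonneg _).trans (hB 0)
  have hinv : Tendsto (fun n : ℕ => ((n : ℝ))⁻¹) atTop (𝓝 0) := tendsto_inv_atTop_nhds_zero_nat
  have hflat : ∀ x : Plane, Tendsto (fun n : ℕ => flatten n (lineDist P k x)) atTop (𝓝 0) :=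
    fun x => squeeze_zero_norm' ((eventually_gt_atTop 0).mono fun n hn => abs_flatten_le hn _) hinv
  have hflat1 : ∀ n : ℕ, 0 < n → ∀ x : Plane, |flatten n (lineDist P k x)| ≤ 1 := by
    intro n hn x
    refine (abs_flatten_le hn _).trans (inv_le_one_of_one_le₀ ?_)
    exact_mod_cast hn
  have hz : ∫ _x in P.Ω, (0 : ℝ) = 0 := integral_zero _ _
  have h1 : Tendsto (fun n => ∫ x in P.Ω, edgeTest P k χ n x ^ 2) atTop (𝓝 0) := by
    rw [← hz]
    refine tendsto_integral_filter_of_dominated_convergence (fun _ => A ^ 2) ?_ ?_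
      (integrable_const _) ?_
    · exact Eventually.of_forall fun n =>
        ((contDiff_edgeTest k hχ n).continuous.pow 2).aestronglyMeasurable
    · filter_upwards [eventually_gt_atTop 0] with n hn
      refine ae_of_all _ fun x => ?_
      rw [norm_pow, edgeTest, norm_mul]
      gcongr
      exact (mul_le_of_le_one_right (norm_nonneg _) (hflat1 n hn x)).trans (hA x)
    · refine ae_of_all _ fun x => ?_
      have := ((hflat x).const_mul (χ x)).pow 2
      simpa [edgeTest] using this
  have h2 : ∀ i, Tendsto (fun n => ∫ x in P.Ω, partialDeriv i (edgeTest P k χ n) x ^ 2) atTop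
      (𝓝 0) := by
    intro i
    rw [← hz]
    refine tendsto_integral_filter_of_dominated_convergence (fun _ => (A + B) ^ 2) ?_ ?_
      (integrable_const _) ?_
    · exact Eventually.of_forall fun n => ((contDiff_partialDeriv
        (contDiff_edgeTest k hχ n) i).continuous.pow 2).aestronglyMeasurable
    · filter_upwards [eventually_gt_atTop 0] with n hn
      refine ae_of_all _ fun x => ?_
      rw [norm_pow, partialDeriv_eq, fderiv_edgeTest k hχ]
      have hw : ‖unitVec i‖ = 1 := by simp [unitVec]
      have e1 : |inner ℝ (P.normal k) (unitVec i)| ≤ 1 := by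
        refine (abs_real_inner_le_norm _ _).trans ?_
        rw [norm_normal, hw, one_mul]
      have e2 : |fderiv ℝ χ x (unitVec i)| ≤ B := by
        rw [← Real.norm_eq_abs]
        refine (ContinuousLinearMap.le_opNorm _ _).trans ?_
        rw [hw, mul_one]; exact hB x
      have e3 : |(1 - ((n : ℝ) * lineDist P k x) ^ 2) / (1 + (n * lineDist P k x) ^ 2) ^ 2| ≤ 1 := by
        refine (abs_deriv_flatten_le n _).trans ?_
        rw [div_le_one (by positivity)]
        nlinarith [sq_nonneg ((n : ℝ) * lineDist P k x)]
      have e4 := hflat1 n hn x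
      gcongr
      refine (norm_add_le _ _).trans (add_le_add ?_ ?_)
      · rw [norm_mul, norm_mul]
        refine (mul_le_of_le_one_right (norm_nonneg _) ?_).trans (hA x)
        exact mul_le_one₀ e3 (abs_nonneg _) e1
      · rw [norm_mul]
        exact (mul_le_of_le_one_left (norm_nonneg _) e4).trans e2
    · filter_upwards [ae_restrict_of_ae (ae_lineDist_ne_zero k)] with x hx
      have := ((((tendsto_deriv_flatten hx).mul_const (inner ℝ (P.normal k) (unitVec i))).const_mul
        (χ x)).add ((hflat x).mul_const (fderiv ℝ χ x (unitVec i)))).pow 2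
      simp only [partialDeriv_eq, fderiv_edgeTest k hχ]
      simpa using this
  have h3 := (h1.add (tendsto_finsetSum Finset.univ fun i _ => h2 i)).sqrt
  simpa [normH1] using h3

end edgeTest

/-- The condition on `N_nn` is necessary. -/
theorem normalNormal_eq_zero {bc : Fin P.K → BoundaryType}
    (hN1 : ∀ i j, IsC1UpToBoundary P.Ω (fun x => N x i j)) (hN : MemHDivDiv P bc N) {k : Fin P.K}
    (hk : bc k ≠ .clamped) : ∀ x ∈ P.edge k, normalNormal P N k x = 0 := by
  obtain ⟨C, -, hC⟩ := exists_bound_boundaryForm hN1 hN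
  obtain ⟨f', hf'⟩ := exists_isBoundedC1_component hN1 (P.normal k) (P.normal k)
  have hfc : ContinuousOn (normalNormal P N k) (P.edge k) :=
    hf'.cont.mono (edge_subset_closure k)
  set U : Set Plane := (⋃ l ∈ {l | l ≠ k}, segment ℝ (P.vertex l) (P.vertex (P.next l)))ᶜ
  have hU : IsOpen U := ((toFinite _).isClosed_biUnion fun l _ =>
    (isCompact_segment l).isClosed).isOpen_compl
  have hkU : P.edge k ⊆ U := by
    intro x hx hx'
    simp only [mem_iUnion] at hx'
    obtain ⟨l, hl, hx'⟩ := hx'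
    exact notMem_segment_of_mem_edge hl hx hx'
  have hlU : ∀ l ≠ k, ∀ x ∈ P.edge l, x ∉ U := fun l hl x hx hx' =>
    hx' (mem_biUnion hl (openSegment_subset_segment ℝ _ _ hx))
  have hae := hU.ae_eq_zero_of_integral_contDiff_smul_eq_zero (μ := μH[1].restrict (P.edge k))
    (f := normalNormal P N k) (hf'.integrableOn_edge k).integrableOn.locallyIntegrableOn (by
      intro χ hχ hc hs
      have hz : ∀ l ≠ k, ∀ φ : Plane → ℝ, tsupport φ ⊆ tsupport χ → ∀ x ∈ P.edge l, φ x = 0 :=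
        fun l hl φ hφ x hx => image_eq_zero_of_notMem_tsupport
          fun hx' => hlU l hl x hx (hs (hφ hx'))
      have hv := fun n => tsupport_edgeTest_subset (P := P) (χ := χ) k n
      have hd := fun n i => (tsupport_partialDeriv_subset (edgeTest P k χ n) i).trans (hv n)
      have hgrad : ∀ n, ∀ x ∈ P.edge k, ∀ w, fderiv ℝ (edgeTest P k χ n) x w =
          χ x * inner ℝ (P.normal k) w := by
        intro n x hx w
        rw [fderiv_edgeTest k hχ, lineDist_eq_zero hx]
        simp
      -- On edge `k` the gradient is `χ` times the normal, for every `n`, so the tangential part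
      -- drops out and the boundary form does not depend on `n`.
      have hform : ∀ n, boundaryForm P N (edgeTest P k χ n) =
          ∫ x in P.edge k, χ x • normalNormal P N k x ∂μH[1] := by
        intro n
        rw [boundaryForm, Finset.sum_eq_single k]
        · refine setIntegral_congr_fun (measurableSet_edge k) fun x hx => ?_
          simp only [← fderiv_eq_sum, hgrad n x hx, real_inner_self_eq_norm_sq, norm_normal,
            real_inner_comm (P.tangent k), inner_tangent_normal, smul_eq_mul]
          ring
        · intro l _ hl
          refine setIntegral_eq_zero_of_forall_eq_zero fun x hx => ?_
          have : ∀ i, partialDeriv i (edgeTest P k χ n) x = 0 := fun i => hz l hl _ (hd n i) x hx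
          simp [this]
        · simp
      have hbound : ∀ n, |∫ x in P.edge k, χ x • normalNormal P N k x ∂μH[1]| ≤
          C * normH1 P.Ω (edgeTest P k χ n) fun i => partialDeriv i (edgeTest P k χ n) := by
        intro n
        rw [← hform n]
        refine hC _ (contDiff_edgeTest k hχ n) (fun l _ x hx => ?_) (fun l hl x hx => ?_)
        · by_cases hlk : l = k
          · subst hlk
            rw [edgeTest, lineDist_eq_zero hx, flatten_zero, mul_zero]
          · exact hz l hlk _ (hv n) x hx
        -- Edge `k` is not clamped, so the condition on the normal derivative only concerns edges
        -- that the support misses.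
        · have hlk : l ≠ k := fun h => hk (h ▸ hl)
          have : ∀ i, partialDeriv i (edgeTest P k χ n) x = 0 := fun i => hz l hlk _ (hd n i) x hx
          simp [this]
      have hlim := (tendsto_normH1_edgeTest (P := P) k hχ hc).const_mul C
      rw [mul_zero] at hlim
      exact abs_nonpos_iff.1 (ge_of_tendsto' hlim hbound))
  -- In the arc length parameter, continuity turns the almost everywhere statement into one for all
  -- points.
  rw [restrict_edge_eq_map, (measurableEmbedding_param k).ae_map_iff] at hae
  have hae' : (fun s => normalNormal P N k (P.param k s)) =ᵐ[volume.restrict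
      (Ioo 0 (P.length k))] fun _ => 0 := by
    filter_upwards [hae, ae_restrict_mem measurableSet_Ioo] with s hs hs'
    exact hs (hkU ((param_mem_edge_iff k s).2 hs'))
  have heq := Measure.eqOn_open_of_ae_eq hae' isOpen_Ioo
    (hfc.comp (continuous_param k).continuousOn fun s hs => (param_mem_edge_iff k s).2 hs)
    continuousOn_const
  intro x hx
  rw [edge_eq_image] at hx
  obtain ⟨s, hs, rfl⟩ := hx
  exact heq hs

end

/-! ### Necessity of the corner conditions -/

section

open PolygonalDomain

variable {P : PolygonalDomain} {N : Plane → Matrix (Fin 2) (Fin 2) ℝ}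

/-- The derivative of a bump function of shrinking support acts like minus a Dirac measure on a ray
starting at its center. -/
lemma tendsto_integral_scaled_deriv_bump {F : ℝ → ℝ} {l : ℝ} (hl : 0 < l)
    (hF : ContinuousOn F (Icc 0 l)) {e : Plane} (he : ‖e‖ = 1) :
    Tendsto (fun j : ℕ => ∫ s in Ioo 0 l, F s *
      ((4 : ℝ) ^ j * fderiv ℝ unitBump (((4 : ℝ) ^ j * s) • e) e)) atTop (𝓝 (-F 0)) := by
  obtain ⟨C, hC0, hC⟩ := exists_bound_fderiv_unitBump
  obtain ⟨M, hM⟩ := isCompact_Icc.exists_bound_of_continuousOn hF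
  set φ' : ℝ → ℝ := fun r => fderiv ℝ unitBump (r • e) e with hφ'
  have hcont' : Continuous φ' := by
    have h1 : Continuous (fderiv ℝ unitBump) :=
      (unitBump.contDiff (n := 1)).continuous_fderiv one_ne_zero
    exact (h1.comp (by fun_prop : Continuous fun r : ℝ => r • e)).clm_apply continuous_const
  have hφ'0 : ∀ r, 2 ≤ r → φ' r = 0 := by
    intro r hr
    have : 2 ≤ ‖r • e‖ := by rw [norm_smul, he, mul_one]; exact hr.trans (le_abs_self r)
    simp [hφ', fderiv_unitBump_eq_zero (Or.inr this)]
  have hderiv : ∀ r : ℝ, HasDerivAt (fun r : ℝ => unitBump (r • e)) (φ' r) r := by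
    intro r
    have h2 : HasFDerivAt unitBump (fderiv ℝ unitBump (r • e)) (r • e) :=
      ((unitBump.contDiff (n := 1)).differentiable one_ne_zero _).hasFDerivAt
    have h3 : HasDerivAt (fun r : ℝ => r • e) e r := by
      simpa using (hasDerivAt_id r).smul_const e
    exact HasFDerivAt.comp_hasDerivAt (l := unitBump) (f := fun r : ℝ => r • e) r h2 h3
  -- Along the ray the bump falls from one to zero, so its derivative has total mass minus one.
  have hftc : ∫ r in (0 : ℝ)..2, φ' r = -1 := by
    rw [intervalIntegral.integral_eq_sub_of_hasDerivAt (fun r _ => hderiv r)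
      (hcont'.intervalIntegrable _ _)]
    rw [unitBump.zero_of_le_dist (by simp [unitBump, norm_smul, he]),
      unitBump.one_of_mem_closedBall (by simp [unitBump])]
    norm_num
  have hlim : Tendsto (fun j : ℕ => ∫ r in (0 : ℝ)..2, F (((4 : ℝ) ^ j)⁻¹ * r) * φ' r) atTop
      (𝓝 (∫ r in (0 : ℝ)..2, F 0 * φ' r)) := by
    have h4 : Tendsto (fun j : ℕ => ((4 : ℝ) ^ j)⁻¹) atTop (𝓝 0) :=
      tendsto_inv_atTop_zero.comp (tendsto_pow_atTop_atTop_of_one_lt (by norm_num))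
    have hev : ∀ᶠ j : ℕ in atTop, ∀ r ∈ Ioc (0 : ℝ) 2, ((4 : ℝ) ^ j)⁻¹ * r ∈ Icc 0 l := by
      filter_upwards [h4.eventually (gt_mem_nhds (by positivity : 0 < l / 2))] with j hj r hr
      have : 0 < ((4 : ℝ) ^ j)⁻¹ := by positivity
      exact ⟨mul_nonneg this.le hr.1.le, by nlinarith [hr.1, hr.2]⟩
    refine intervalIntegral.tendsto_integral_filter_of_dominated_convergence (fun _ => M * C)
      ?_ ?_ intervalIntegrable_const ?_
    · filter_upwards [hev] with j hj
      rw [uIoc_of_le zero_le_two]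
      exact ((hF.comp (by fun_prop) hj).mul hcont'.continuousOn).aestronglyMeasurable
        measurableSet_Ioc
    · filter_upwards [hev] with j hj
      refine ae_of_all _ fun r hr => ?_
      rw [uIoc_of_le zero_le_two] at hr
      have h5 := hM _ (hj r hr)
      rw [norm_mul]
      refine mul_le_mul h5 ?_ (norm_nonneg _) ((norm_nonneg _).trans h5)
      refine (ContinuousLinearMap.le_opNorm _ _).trans ?_
      rw [he, mul_one]; exact hC _
    · refine ae_of_all _ fun r hr => Tendsto.mul_const _ ?_
      rw [uIoc_of_le zero_le_two] at hr
      have h5 : Tendsto F (𝓝[Icc 0 l] 0) (𝓝 (F 0)) := hF 0 ⟨le_rfl, hl.le⟩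
      refine h5.comp (tendsto_nhdsWithin_iff.2 ⟨?_, hev.mono fun j hj => hj r hr⟩)
      simpa using h4.mul_const r
  rw [intervalIntegral.integral_const_mul, hftc, mul_neg_one] at hlim
  refine hlim.congr' ?_
  -- The substitution `r = 4 ^ j * s` stretches the interval to length `4 ^ j * l`. For these `j` it
  -- covers `(0, 2]`, beyond which the derivative vanishes.
  have h4 : ∀ᶠ j : ℕ in atTop, 2 / l ≤ (4 : ℝ) ^ j :=
    (tendsto_pow_atTop_atTop_of_one_lt (by norm_num)).eventually_ge_atTop _
  filter_upwards [h4] with j hj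
  have hpos : (0 : ℝ) < 4 ^ j := by positivity
  have h2l : 2 ≤ (4 : ℝ) ^ j * l := by rwa [div_le_iff₀ hl] at hj
  rw [← integral_Ioc_eq_integral_Ioo, ← intervalIntegral.integral_of_le hl.le]
  have h6 : ∀ s : ℝ, F s * ((4 : ℝ) ^ j * fderiv ℝ unitBump (((4 : ℝ) ^ j * s) • e) e) =
      (4 : ℝ) ^ j * (fun r => F (((4 : ℝ) ^ j)⁻¹ * r) * φ' r) ((4 : ℝ) ^ j * s) := by
    intro s
    simp only [hφ', inv_mul_cancel_left₀ hpos.ne']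
    ring
  simp only [h6]
  have h7 := intervalIntegral.integral_comp_mul_left (a := 0) (b := l)
    (fun r => F (((4 : ℝ) ^ j)⁻¹ * r) * φ' r) hpos.ne'
  beta_reduce at h7
  rw [intervalIntegral.integral_const_mul, h7, smul_eq_mul, mul_inv_cancel_left₀ hpos.ne', mul_zero,
    intervalIntegral.integral_of_le zero_le_two, intervalIntegral.integral_of_le (by linarith)]
  refine (setIntegral_eq_of_subset_of_forall_sdiff_eq_zero measurableSet_Ioc
    (Ioc_subset_Ioc_right h2l) fun r hr => ?_).symm
  rw [hφ'0 r, mul_zero]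
  by_contra! h
  exact hr.2 ⟨hr.1.1, h.le⟩

/-- The boundary integral over the two edges at a corner for the bump function around it. -/
def cornerForm (P : PolygonalDomain) (N : Plane → Matrix (Fin 2) (Fin 2) ℝ) (k : Fin P.K)
    (v : Plane → ℝ) : ℝ :=
  (∫ x in P.edge k, normalTangential P N k x * fderiv ℝ v x (P.tangent k) ∂μH[1]) +
  ∫ x in P.edge (P.next k), normalTangential P N (P.next k) x *
    fderiv ℝ v x (P.tangent (P.next k)) ∂μH[1]

lemma param_mem_closure (k : Fin P.K) {s : ℝ} (hs : s ∈ Icc 0 (P.length k)) :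
    P.param k s ∈ closure P.Ω := by
  refine frontier_subset_closure (segment_subset_frontier k ?_)
  rw [segment_eq_insert]
  rcases hs.1.eq_or_lt with rfl | h0
  · simp
  rcases hs.2.eq_or_lt with rfl | h1
  · simp
  · exact Or.inr (Or.inr ((param_mem_edge_iff k s).2 ⟨h0, h1⟩))

/-- Edge `k` runs into the corner and `P.next k` runs out of it. Seen from the corner, edge `k` is
the ray in direction `-P.tangent k`, which reverses the sign of its contribution; so the two limits
form a difference, the jump. -/
lemma tendsto_cornerForm (hN1 : ∀ i j, IsC1UpToBoundary P.Ω (fun x => N x i j)) (k : Fin P.K) :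
    Tendsto (fun j : ℕ => cornerForm P N k (scaledBump (P.vertex (P.next k)) (4 ^ j))) atTop
      (𝓝 (cornerJump P N k)) := by
  set p := P.vertex (P.next k)
  have hc : ∀ l, ContinuousOn (fun s => normalTangential P N l (P.param l s))
      (Icc 0 (P.length l)) := fun l =>
    (continuousOn_component hN1 _ _).comp (continuous_param l).continuousOn
      fun s hs => param_mem_closure l hs
  have h2 := tendsto_integral_scaled_deriv_bump (length_pos (P.next k)) (hc (P.next k))
    (norm_tangent (P.next k))
  have h1 := tendsto_integral_scaled_deriv_bump (length_pos k)
    (F := fun s => normalTangential P N k (P.param k (P.length k - s)))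
    ((hc k).comp (f := fun s => P.length k - s) (by fun_prop) fun s hs =>
      ⟨by linarith [hs.2], by linarith [hs.1]⟩)
    (e := -P.tangent k) (by rw [norm_neg, norm_tangent])
  have h := h1.neg.add h2
  simp only [sub_zero, param_length, param_zero, neg_neg] at h
  rw [cornerJump, sub_eq_add_neg]
  refine h.congr fun j => ?_
  rw [cornerForm, setIntegral_edge, setIntegral_edge]
  congr 1
  · rw [← integral_Ioc_eq_integral_Ioo, ← integral_Ioc_eq_integral_Ioo,
      ← intervalIntegral.integral_of_le (length_pos k).le,
      ← intervalIntegral.integral_of_le (length_pos k).le, ← intervalIntegral.integral_neg]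
    have h0 := intervalIntegral.integral_comp_sub_left (a := 0) (b := P.length k)
      (fun s => normalTangential P N k (P.param k s) *
        fderiv ℝ (scaledBump p (4 ^ j)) (P.param k s) (P.tangent k)) (P.length k)
    rw [sub_self, sub_zero] at h0
    rw [← h0]
    congr 1
    ext s
    have : P.param k (P.length k - s) - p = s • (-P.tangent k) := by
      simp only [p]
      rw [← param_length k, param, param]; module
    rw [fderiv_scaledBump, this, smul_smul]
    simp
  · congr 1
    ext s
    have : P.param (P.next k) s - p = s • P.tangent (P.next k) := by
      simp only [p, param]; module
    rw [fderiv_scaledBump, this, smul_smul]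
    simp

/-- Sums of bump functions on geometric scales. -/
def multiBump (p : Plane) (m n : ℕ) (x : Plane) : ℝ :=
  ∑ j ∈ Finset.range n, scaledBump p (4 ^ (m + j)) x

section multiBump

variable (p : Plane) (m n : ℕ)

lemma contDiff_multiBump : ContDiff ℝ ∞ (multiBump p m n) :=
  ContDiff.sum fun _ _ => contDiff_scaledBump _ _

lemma fderiv_multiBump (x : Plane) : fderiv ℝ (multiBump p m n) x =
    ∑ j ∈ Finset.range n, fderiv ℝ (scaledBump p (4 ^ (m + j))) x :=
  fderiv_fun_sum fun _ _ => (contDiff_scaledBump _ _).differentiable (by simp) _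

lemma two_le_norm_smul_of_le {x : Plane} (h : 2 ≤ ‖(4 : ℝ) ^ m • (x - p)‖) (j : ℕ) :
    2 ≤ ‖(4 : ℝ) ^ (m + j) • (x - p)‖ := by
  rw [norm_smul, norm_pow, Real.norm_ofNat] at h ⊢
  refine h.trans (mul_le_mul_of_nonneg_right ?_ (norm_nonneg _))
  exact pow_le_pow_right₀ (by norm_num) (Nat.le_add_right _ _)

lemma multiBump_eq_zero {x : Plane} (h : 2 ≤ ‖(4 : ℝ) ^ m • (x - p)‖) : multiBump p m n x = 0 :=
  Finset.sum_eq_zero fun j _ => scaledBump_eq_zero _ _ (two_le_norm_smul_of_le p m h j)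

lemma fderiv_multiBump_eq_zero {x : Plane} (h : 2 ≤ ‖(4 : ℝ) ^ m • (x - p)‖) :
    fderiv ℝ (multiBump p m n) x = 0 := by
  rw [fderiv_multiBump]
  refine Finset.sum_eq_zero fun j _ => ?_
  rw [fderiv_scaledBump, fderiv_unitBump_eq_zero (Or.inr (two_le_norm_smul_of_le p m h j)),
    smul_zero]

lemma setIntegral_sq_le_of_support {c K : ℝ} (hc : 0 < c) {F : Plane → ℝ}
    (hK : ∀ x, |F x| ≤ K) (h0 : ∀ x, 2 ≤ ‖c • (x - p)‖ → F x = 0) :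
    ∫ x in P.Ω, F x ^ 2 ≤ K ^ 2 * (4 / c ^ 2 * volume.real (Metric.ball (0 : Plane) 1)) := by
  rw [← measureReal_closedBall_div p hc, setIntegral_eq_of_subset_of_forall_sdiff_eq_zero
    P.isOpen.measurableSet (s := P.Ω ∩ Metric.closedBall p (2 / c)) inter_subset_left]
  · refine (Real.le_norm_self _).trans ((norm_setIntegral_le_of_norm_le_const (C := K ^ 2) ?_ ?_).trans ?_)
    · exact (measure_mono inter_subset_right).trans_lt (isCompact_closedBall p (2 / c)).measure_lt_top
    · intro x _
      rw [norm_pow]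
      exact pow_le_pow_left₀ (norm_nonneg _) (hK x) 2
    · gcongr
      · exact (isCompact_closedBall p (2 / c)).measure_lt_top.ne
      · exact inter_subset_right
  · rintro x ⟨hx, hx'⟩
    rw [h0 x, zero_pow two_ne_zero]
    rw [norm_smul, Real.norm_of_nonneg hc.le, mul_comm, ← div_le_iff₀ hc, ← dist_eq_norm]
    by_contra! h
    exact hx' ⟨hx, h.le⟩

/-- All mixed products vanish: the gradient at scale `c` is nonzero only where `1 < c * ‖x - p‖ <
2`, and scales differing by a factor of at least four give disjoint annuli. -/
lemma sq_partialDeriv_multiBump (i : Fin 2) (x : Plane) :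
    partialDeriv i (multiBump p m n) x ^ 2 =
      ∑ j ∈ Finset.range n, partialDeriv i (scaledBump p (4 ^ (m + j))) x ^ 2 := by
  have horth : ∀ j l, j < l → partialDeriv i (scaledBump p (4 ^ (m + j))) x *
      partialDeriv i (scaledBump p (4 ^ (m + l))) x = 0 := by
    intro j l hjl
    simp only [partialDeriv_eq, fderiv_scaledBump]
    by_cases h : ‖(4 : ℝ) ^ (m + j) • (x - p)‖ ≤ 1
    · rw [fderiv_unitBump_eq_zero (Or.inl h)]; simp
    · have h2 : 2 ≤ ‖(4 : ℝ) ^ (m + l) • (x - p)‖ := by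
        push Not at h
        rw [norm_smul, norm_pow, Real.norm_ofNat] at h ⊢
        have h3 : (4 : ℝ) ^ (m + l) = 4 ^ (l - j) * 4 ^ (m + j) := by
          rw [← pow_add]; congr 1; omega
        have h4 : (4 : ℝ) ≤ 4 ^ (l - j) := le_self_pow₀ (by norm_num) (by omega)
        rw [h3, mul_assoc]
        nlinarith
      rw [fderiv_unitBump_eq_zero (Or.inr h2)]; simp
  have hsum : partialDeriv i (multiBump p m n) x =
      ∑ j ∈ Finset.range n, partialDeriv i (scaledBump p (4 ^ (m + j))) x := by
    simp only [partialDeriv_eq, fderiv_multiBump, _root_.sum_apply]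
  rw [hsum, sq, Finset.sum_mul_sum]
  refine Finset.sum_congr rfl fun j hj => ?_
  rw [Finset.sum_eq_single_of_mem j hj, sq]
  intro l _ hlj
  rcases lt_or_gt_of_ne hlj with h | h
  · rw [mul_comm]; exact horth l j h
  · exact horth j l h

end multiBump

/-- The Dirichlet integral of `n` bump functions on disjoint scales grows only linearly. -/
lemma exists_bound_normH1_multiBump (P : PolygonalDomain) (p : Plane) : ∃ D, ∀ m n : ℕ,
    normH1 P.Ω (multiBump p m n) (fun i => partialDeriv i (multiBump p m n)) ≤
      √((n : ℝ) ^ 2 * D * ((1 / 16 : ℝ)) ^ m + n * D) := by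
  obtain ⟨C, hC0, hC⟩ := exists_bound_fderiv_unitBump
  set V := volume.real (Metric.ball (0 : Plane) 1)
  have hV : 0 ≤ V := measureReal_nonneg
  -- The summand `4 * V` comes from the L² part, where the function is at most `n` on a disc of area
  -- `4 * V / 16 ^ m`. The other comes from two partial derivatives with `4 * C ^ 2 * V` each.
  refine ⟨4 * V + 8 * C ^ 2 * V, fun m n => Real.sqrt_le_sqrt ?_⟩
  have hpow : ∀ j : ℕ, ((4 : ℝ) ^ j) ^ 2 = 16 ^ j := by
    intro j; rw [← pow_mul, mul_comm, pow_mul]; norm_num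
  have h1 : ∫ x in P.Ω, multiBump p m n x ^ 2 ≤ (n : ℝ) ^ 2 * (4 / ((4 : ℝ) ^ m) ^ 2 * V) := by
    refine setIntegral_sq_le_of_support p (by positivity) (fun x => ?_)
      (fun x hx => multiBump_eq_zero p m n hx)
    refine (Finset.abs_sum_le_sum_abs _ _).trans ?_
    refine (Finset.sum_le_sum fun j _ => abs_scaledBump_le_one _ _ _).trans ?_
    simp
  -- The Dirichlet integral is scale invariant in the plane: the squared gradient grows by `16 ^ j`
  -- and the area shrinks by the same factor.
  have h2 : ∀ i (j : ℕ), ∫ x in P.Ω, partialDeriv i (scaledBump p (4 ^ j)) x ^ 2 ≤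
      4 * C ^ 2 * V := by
    intro i j
    have hpos : (0 : ℝ) < 4 ^ j := by positivity
    refine (setIntegral_sq_le_of_support p (K := 4 ^ j * C) hpos (fun x => ?_)
      (fun x hx => ?_)).trans_eq ?_
    · rw [partialDeriv_eq, fderiv_scaledBump, ← Real.norm_eq_abs]
      refine (ContinuousLinearMap.le_opNorm _ _).trans ?_
      have : ‖unitVec i‖ = 1 := by simp [unitVec]
      rw [this, mul_one, norm_smul, Real.norm_of_nonneg hpos.le]
      gcongr
      exact hC _
    · rw [partialDeriv_eq, fderiv_scaledBump, fderiv_unitBump_eq_zero (Or.inr hx)]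
      simp
    · simp only [V]
      field_simp
  have h3 : ∀ i, ∫ x in P.Ω, partialDeriv i (multiBump p m n) x ^ 2 ≤ n * (4 * C ^ 2 * V) := by
    intro i
    simp only [sq_partialDeriv_multiBump]
    rw [integral_finsetSum]
    · refine (Finset.sum_le_sum fun j _ => h2 i (m + j)).trans_eq ?_
      simp
    · intro j _
      have := memL2_of_smooth (P := P) (contDiff_partialDeriv (contDiff_scaledBump p (4 ^ (m + j))) i)
      exact this.integrable_sq
  have h4 : (n : ℝ) ^ 2 * (4 / ((4 : ℝ) ^ m) ^ 2 * V) ≤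
      (n : ℝ) ^ 2 * (4 * V + 8 * C ^ 2 * V) * (1 / 16 : ℝ) ^ m := by
    rw [hpow, one_div_pow]
    have : (n : ℝ) ^ 2 * (4 / 16 ^ m * V) = (n : ℝ) ^ 2 * (4 * V) * (1 / 16 ^ m) := by ring
    rw [this]
    gcongr
    have : 0 ≤ 8 * C ^ 2 * V := by positivity
    linarith
  have h5 : (n : ℝ) * (4 * C ^ 2 * V) + n * (4 * C ^ 2 * V) ≤ n * (4 * V + 8 * C ^ 2 * V) := by
    have : 0 ≤ (n : ℝ) * (4 * V) := by positivity
    linarith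
  rw [Fin.sum_univ_two]
  linarith [h3 0, h3 1]

/-- The condition on the corner jumps is necessary. -/
theorem cornerJump_eq_zero {bc : Fin P.K → BoundaryType}
    (hN1 : ∀ i j, IsC1UpToBoundary P.Ω (fun x => N x i j)) (hN : MemHDivDiv P bc N) {k : Fin P.K}
    (hk : bc k = .free) (hk' : bc (P.next k) = .free) : cornerJump P N k = 0 := by
  obtain ⟨C, hC0, hC⟩ := exists_bound_boundaryForm hN1 hN
  set p := P.vertex (P.next k)
  obtain ⟨D, hD⟩ := exists_bound_normH1_multiBump P p
  have hcl : IsClosed (⋃ l ∈ {l | l ≠ k ∧ l ≠ P.next k},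
      segment ℝ (P.vertex l) (P.vertex (P.next l))) :=
    (toFinite _).isClosed_biUnion fun l _ => (isCompact_segment l).isClosed
  have hp : p ∈ (⋃ l ∈ {l | l ≠ k ∧ l ≠ P.next k},
      segment ℝ (P.vertex l) (P.vertex (P.next l)))ᶜ := by
    intro h
    simp only [mem_iUnion] at h
    obtain ⟨l, ⟨h1, h2⟩, h⟩ := h
    exact vertex_notMem_segment h1 h2 h
  obtain ⟨r, hr, hball⟩ := Metric.isOpen_iff.1 hcl.isOpen_compl p hp
  -- For large `m` the test functions vanish on all edges except the two free ones at the corner, so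
  -- they satisfy the boundary conditions.
  have hfar : ∀ᶠ m : ℕ in atTop, ∀ l, l ≠ k → l ≠ P.next k → ∀ x ∈ P.edge l,
      2 ≤ ‖(4 : ℝ) ^ m • (x - p)‖ := by
    have h4 : ∀ᶠ m : ℕ in atTop, 2 / r ≤ (4 : ℝ) ^ m :=
      (tendsto_pow_atTop_atTop_of_one_lt (by norm_num)).eventually_ge_atTop _
    filter_upwards [h4] with m hm l h1 h2 x hx
    have hxr : r ≤ ‖x - p‖ := by
      by_contra! h
      have hl' : l ∈ {l | l ≠ k ∧ l ≠ P.next k} := ⟨h1, h2⟩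
      exact hball (mem_ball_iff_norm.2 h) (mem_biUnion hl' (openSegment_subset_segment ℝ _ _ hx))
    rw [norm_smul, norm_pow, Real.norm_ofNat]
    rw [div_le_iff₀ hr] at hm
    exact hm.trans (mul_le_mul_of_nonneg_left hxr (by positivity))
  have hform : ∀ n, ∀ᶠ m : ℕ in atTop, boundaryForm P N (multiBump p m n) =
      ∑ j ∈ Finset.range n, cornerForm P N k (scaledBump p (4 ^ (m + j))) := by
    intro n
    filter_upwards [hfar] with m hm
    have hint : ∀ l (j : ℕ), IntegrableOn (fun x => normalTangential P N l x *
        fderiv ℝ (scaledBump p (4 ^ (m + j))) x (P.tangent l)) (P.edge l) μH[1] := by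
      intro l j
      obtain ⟨f', hf'⟩ := exists_isBoundedC1_component hN1 (P.normal l) (P.tangent l)
      have hsm : ContDiff ℝ ∞ fun x => fderiv ℝ (scaledBump p (4 ^ (m + j))) x (P.tangent l) :=
        ((contDiff_scaledBump p _).fderiv_right (m := ∞) (by simp)).clm_apply contDiff_const
      exact (hf'.mul (isBoundedC1_of_smooth hsm)).integrableOn_edge l
    -- On free edges the normal part is already removed by `normalNormal_eq_zero`.
    have hedge : ∀ l, bc l = .free → ∫ x in P.edge l, (normalNormal P N l x *
        ∑ i, partialDeriv i (multiBump p m n) x * P.normal l i + normalTangential P N l x *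
        ∑ i, partialDeriv i (multiBump p m n) x * P.tangent l i) ∂μH[1] =
        ∑ j ∈ Finset.range n, ∫ x in P.edge l, normalTangential P N l x *
          fderiv ℝ (scaledBump p (4 ^ (m + j))) x (P.tangent l) ∂μH[1] := by
      intro l hl
      rw [← integral_finsetSum _ fun j _ => hint l j]
      refine setIntegral_congr_fun (measurableSet_edge l) fun x hx => ?_
      simp only
      rw [normalNormal_eq_zero hN1 hN (by rw [hl]; exact nofun) x hx, zero_mul,
        zero_add, ← fderiv_eq_sum, fderiv_multiBump, _root_.sum_apply, Finset.mul_sum]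
    rw [boundaryForm, ← Finset.sum_subset (Finset.subset_univ {k, P.next k}),
      Finset.sum_pair (P.next_ne k).symm, hedge k hk, hedge _ hk', ← Finset.sum_add_distrib]
    · rfl
    · intro l _ hl
      simp only [Finset.mem_insert, Finset.mem_singleton, not_or] at hl
      refine setIntegral_eq_zero_of_forall_eq_zero fun x hx => ?_
      simp only [← fderiv_eq_sum, fderiv_multiBump_eq_zero p m n (hm l hl.1 hl.2 x hx)]
      simp
  have hbound : ∀ n, ∀ᶠ m : ℕ in atTop,
      |∑ j ∈ Finset.range n, cornerForm P N k (scaledBump p (4 ^ (m + j)))| ≤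
        C * √((n : ℝ) ^ 2 * D * ((1 / 16 : ℝ)) ^ m + n * D) := by
    intro n
    filter_upwards [hform n, hfar] with m hm hm'
    rw [← hm]
    have hne : ∀ l, bc l ≠ .free → ∀ x ∈ P.edge l, 2 ≤ ‖(4 : ℝ) ^ m • (x - p)‖ :=
      fun l hl => hm' l (fun h => hl (h ▸ hk)) (fun h => hl (h ▸ hk'))
    refine (hC _ (contDiff_multiBump p m n) (fun l hl x hx => ?_) (fun l hl x hx => ?_)).trans
      (mul_le_mul_of_nonneg_left (hD m n) hC0)
    · exact multiBump_eq_zero p m n (hne l (by rcases hl with h | h <;> rw [h] <;> exact nofun) x hx)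
    · rw [← fderiv_eq_sum, fderiv_multiBump_eq_zero p m n
        (hne l (by rw [hl]; exact nofun) x hx)]
      simp
  -- With `n` fixed and `m → ∞`, each of the `n` bumps contributes one jump, and the L² part of the
  -- norm disappears.
  have hlim : ∀ n : ℕ, |n * cornerJump P N k| ≤ C * √(n * D) := by
    intro n
    have h1 : Tendsto (fun m : ℕ => |∑ j ∈ Finset.range n,
        cornerForm P N k (scaledBump p (4 ^ (m + j)))|) atTop (𝓝 |n * cornerJump P N k|) := by
      have := tendsto_finsetSum (Finset.range n) fun j _ =>
        (tendsto_add_atTop_iff_nat j).2 (tendsto_cornerForm hN1 k)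
      simpa using this.abs
    have h2 : Tendsto (fun m : ℕ => C * √((n : ℝ) ^ 2 * D * ((1 / 16 : ℝ)) ^ m + n * D)) atTop
        (𝓝 (C * √(n * D))) := by
      have h3 : Tendsto (fun m : ℕ => (1 / 16 : ℝ) ^ m) atTop (𝓝 0) :=
        tendsto_pow_atTop_nhds_zero_of_lt_one (by norm_num) (by norm_num)
      simpa using (((h3.const_mul ((n : ℝ) ^ 2 * D)).add_const (n * D)).sqrt).const_mul C
    exact le_of_tendsto_of_tendsto h1 h2 (hbound n)
  by_contra hJ
  have hJ' : 0 < cornerJump P N k ^ 2 := by positivity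
  -- Squaring `hlim` gives `n ^ 2 * J ^ 2 ≤ C ^ 2 * n * |D|` for the jump `J`, which fails for this
  -- `n`. The absolute value is taken because the sign of `D` is not recorded.
  obtain ⟨n, hn⟩ := exists_nat_gt (C ^ 2 * |D| / cornerJump P N k ^ 2)
  rw [div_lt_iff₀ hJ'] at hn
  have hn0 : (0 : ℝ) < n := by
    rcases Nat.eq_zero_or_pos n with rfl | h
    · have : 0 ≤ C ^ 2 * |D| := by positivity
      simp at hn; linarith
    · exact_mod_cast h
  have h1 := pow_le_pow_left₀ (abs_nonneg _) (hlim n) 2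
  have h2 : √(n * D) ^ 2 ≤ n * |D| := by
    rw [← Real.sq_sqrt (by positivity : 0 ≤ (n : ℝ) * |D|)]
    gcongr
    exact le_abs_self D
  rw [sq_abs, mul_pow, mul_pow] at h1
  have h3 : C ^ 2 * √(n * D) ^ 2 ≤ C ^ 2 * (n * |D|) := by gcongr
  nlinarith

end

end Plate

end

theorem mainTheorem4 (P : Plate.PolygonalDomain) (bc : Fin P.K → Plate.BoundaryType)
    (N : Plate.Plane → Matrix (Fin 2) (Fin 2) ℝ) (hN : Plate.MemL2Sym P.Ω N)
    (hN1 : ∀ i j, Plate.IsC1UpToBoundary P.Ω (fun x => N x i j)) :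
    Plate.MemHDivDiv P bc N ↔
      (∀ k, bc k = .simplySupported ∨ bc k = .free →
        ∀ x ∈ P.edge k, Plate.normalNormal P N k x = 0) ∧
      (∀ k, bc k = .free → bc (P.next k) = .free → Plate.cornerJump P N k = 0) := by
  refine ⟨fun h => ⟨fun k hk => Plate.normalNormal_eq_zero hN1 h ?_,
    fun k hk hk' => Plate.cornerJump_eq_zero hN1 h hk hk'⟩,
    fun h => Plate.memHDivDiv_of_boundary_conditions bc hN hN1 h.1 h.2⟩
  rcases hk with hk | hk <;> rw [hk] <;> exact nofun
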